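/- Let $(M,g)$ be a smooth Riemannian manifold (Hausdorff, second countable, without boundary) of dimension $n$, let $1<p<\infty$, and let $\Omega\subset M$ be a domain (a nonempty connected open set) with $\partial\Omega\neq\emptyset$. Integrals are taken with respect to the Riemannian volume. Let $W^{1,p}_0(\Omega)$ be the closure of the smooth functions with compact support in $\Omega$ for the norm $\|u\|_{1,p}^p=\int_\Omega|u|^p+\int_\Omega\|\nabla u\|^p$, and let $$\mu_p^*(\Omega)=\inf\left\{\frac{\int_\Omega\|\nabla f\|^p}{\int_\Omega|f|^p}\;:\; f\in W_0^{1,p}(\Omega),\ f\neq0\right\}$$ be the $p$-fundamental tone of $\Omega$. Let $\mathfrak X(\Omega)$ be the set of smooth vector fields $X$ on $\Omega$ with $\|X\|_\infty=\sup_\Omega\|X\|<\infty$ and $\inf_\Omega\operatorname{div}X>0$, and let $$c(\Omega)=\sup\left\{\frac{\inf_\Omega\operatorname{div}X}{\|X\|_\infty}\;:\;X\in\mathfrak X(\Omega)\right\}\in[0,\infty],\qquad \sup\emptyset=0 .$$ Then $$\mu_p^*(\Omega)\ \ge\ \frac{c(\Omega)^p}{p^p}.$$ If moreover $\overline\Omega$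 is compact and $M_0\setminus\Omega$ contains a nonempty embedded smooth hypersurface, where $M_0$ is the connected component of $M$ that contains $\Omega$ (for $n\ge1$ this holds, for example, whenever $\overline\Omega\neq M_0$, and whenever some piece of $\partial\Omega$ is a smooth hypersurface), then $$\frac{c(\Omega)^p}{p^p}>0 .$$ -/

import Mathlib

open scoped Manifold ContDiff ENNReal
open Bundle MeasureTheory

noncomputable section

namespace PTone

/-- A smooth Riemannian metric on a smooth `n`-manifold `M`: a smoothly varying family of inner
products `g.inner x` on the tangent spaces. -/
abbrev Metric (n : ℕ) (M : Type*) [TopologicalSpace M]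
    [ChartedSpace (EuclideanSpace ℝ (Fin n)) M] [IsManifold (𝓡 n) ∞ M] :=
  ContMDiffRiemannianMetric (𝓡 n) ∞ (EuclideanSpace ℝ (Fin n)) (fun x : M => TangentSpace (𝓡 n) x)

/-- A (not necessarily continuous) vector field. -/
abbrev VField (n : ℕ) (M : Type*) [TopologicalSpace M]
    [ChartedSpace (EuclideanSpace ℝ (Fin n)) M] :=
  (x : M) → TangentSpace (𝓡 n) x

section

variable {n : ℕ} {M : Type*} [TopologicalSpace M] [ChartedSpace (EuclideanSpace ℝ (Fin n)) M]

/-- The `i`-th coordinate vector field `∂ᵢ` of the preferred chart at `x`, at the point with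
coordinates `y`. -/
def coordVec (x : M) (i : Fin n) (y : EuclideanSpace ℝ (Fin n)) :
    TangentSpace (𝓡 n) ((extChartAt (𝓡 n) x).symm y) :=
  mfderiv (𝓡 n) (𝓡 n) (extChartAt (𝓡 n) x).symm y
    (EuclideanSpace.single i (1 : ℝ) : EuclideanSpace ℝ (Fin n))

/-- The `i`-th component `Xⁱ` of a vector field in the preferred chart at `x`, as a function of the
coordinates `y`. -/
def coordComp (X : VField n M) (x : M) (i : Fin n) (y : EuclideanSpace ℝ (Fin n)) : ℝ :=
  (show EuclideanSpace ℝ (Fin n) from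
    mfderiv (𝓡 n) (𝓡 n) (extChartAt (𝓡 n) x) ((extChartAt (𝓡 n) x).symm y)
      (X ((extChartAt (𝓡 n) x).symm y))) i

/-- `A` contains a nonempty embedded smooth hypersurface: there is a chart of the smooth structure,
meeting the hyperplane `{yᵢ = 0}`, in which this coordinate hyperplane lies in `A`. -/
def ContainsHypersurface (n : ℕ) {M : Type*} [TopologicalSpace M]
    [ChartedSpace (EuclideanSpace ℝ (Fin n)) M] (A : Set M) : Prop :=
  ∃ e ∈ IsManifold.maximalAtlas (𝓡 n) ∞ M, ∃ i : Fin n,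
    (∃ x ∈ e.source, e x i = 0) ∧ ∀ x ∈ e.source, e x i = 0 → x ∈ A

/-- A real function in `C_c^∞(Ω)`. -/
structure IsTestFunction (n : ℕ) {M : Type*} [TopologicalSpace M]
    [ChartedSpace (EuclideanSpace ℝ (Fin n)) M] (Ω : Set M) (f : M → ℝ) : Prop where
  smooth : ContMDiff (𝓡 n) 𝓘(ℝ, ℝ) ∞ f
  compact : HasCompactSupport f
  supp : tsupport f ⊆ Ω

variable [IsManifold (𝓡 n) ∞ M]

/-- The length `‖v‖ = g(v, v)^{1/2}` of a tangent vector. -/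
def vnorm (g : Metric n M) {x : M} (v : TangentSpace (𝓡 n) x) : ℝ :=
  Real.sqrt (g.inner x v v)

/-- The Riesz representation of a covector with respect to the metric. -/
theorem exists_riesz (g : Metric n M) (x : M) (α : TangentSpace (𝓡 n) x →L[ℝ] ℝ) :
    ∃ v : TangentSpace (𝓡 n) x, ∀ w, g.inner x v w = α w := by
  have : FiniteDimensional ℝ (TangentSpace (𝓡 n) x) :=
    inferInstanceAs (FiniteDimensional ℝ (EuclideanSpace ℝ (Fin n)))
  let L : TangentSpace (𝓡 n) x →ₗ[ℝ] Module.Dual ℝ (TangentSpace (𝓡 n) x) :=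
    { toFun := fun v => (g.inner x v).toLinearMap
      map_add' := fun v w => by ext; simp
      map_smul' := fun c v => by ext; simp }
  have hinj : Function.Injective L := by
    rw [injective_iff_map_eq_zero]
    intro v hv
    by_contra hne
    have h1 : g.inner x v v = 0 := LinearMap.congr_fun hv v
    exact absurd h1 (g.pos x v hne).ne'
  have hsurj : Function.Surjective L :=
    (LinearMap.injective_iff_surjective_of_finrank_eq_finrank
      (Subspace.dual_finrank_eq).symm).1 hinj
  obtain ⟨v, hv⟩ := hsurj α.toLinearMap
  exact ⟨v, fun w => LinearMap.congr_fun hv w⟩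

/-- The gradient `∇f`: the vector field with `g(∇f, w) = df(w)` for all `w`. -/
def grad (g : Metric n M) (f : M → ℝ) : VField n M := fun x =>
  Classical.choose (exists_riesz g x (mfderiv (𝓡 n) 𝓘(ℝ, ℝ) f x))

theorem inner_grad (g : Metric n M) (f : M → ℝ) (x : M) (w : TangentSpace (𝓡 n) x) :
    g.inner x (grad g f x) w = mfderiv (𝓡 n) 𝓘(ℝ, ℝ) f x w :=
  Classical.choose_spec (exists_riesz g x (mfderiv (𝓡 n) 𝓘(ℝ, ℝ) f x)) w

/-- The density `√det(g_{ij})` of the preferred chart at `x`, where `g_{ij} = g(∂ᵢ, ∂ⱼ)`. -/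
def density (g : Metric n M) (x : M) (y : EuclideanSpace ℝ (Fin n)) : ℝ :=
  Real.sqrt (Matrix.det (Matrix.of fun i j : Fin n =>
    g.inner ((extChartAt (𝓡 n) x).symm y) (coordVec x i y) (coordVec x j y)))

/-- The divergence `div X = (1/√det g) ∑ᵢ ∂ᵢ(√det g Xⁱ)`, computed at `x` in the preferred chart
at `x`. -/
def divergence (g : Metric n M) (X : VField n M) (x : M) : ℝ :=
  (density g x (extChartAt (𝓡 n) x x))⁻¹ *
    ∑ i : Fin n, fderiv ℝ (fun y => density g x y * coordComp X x i y)
      (extChartAt (𝓡 n) x x) (EuclideanSpace.single i (1 : ℝ))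

/-- The measure `√det(g_{ij}) dy¹⋯dyⁿ` on the domain of the preferred chart at `x` (and `0`
outside). -/
def chartVolume (g : Metric n M) [MeasurableSpace M] (x : M) : Measure M :=
  ((volume.restrict (extChartAt (𝓡 n) x).target).withDensity
    (fun y => ENNReal.ofReal (density g x y))).map (extChartAt (𝓡 n) x).symm

/-- The Riemannian volume measure: the smallest measure that dominates `√det(g_{ij}) dy¹⋯dyⁿ` in
each chart. Since these measures agree on overlaps of charts, it is (on a second countable manifold)
the unique Borel measure that equals `√det(g_{ij}) dy¹⋯dyⁿ` in each chart. -/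
def riemVolume (g : Metric n M) [MeasurableSpace M] : Measure M :=
  ⨆ x : M, chartVolume g x

/-- The energy `∫_Ω ‖V‖^p`. -/
def energy (g : Metric n M) [MeasurableSpace M] (p : ℝ) (Ω : Set M) (V : VField n M) : ℝ≥0∞ :=
  ∫⁻ x in Ω, ENNReal.ofReal (vnorm g (V x)) ^ p ∂(riemVolume g)

/-- The mass `∫_Ω |f|^p`. -/
def mass (g : Metric n M) [MeasurableSpace M] (p : ℝ) (Ω : Set M) (f : M → ℝ) : ℝ≥0∞ :=
  ∫⁻ x in Ω, ENNReal.ofReal |f x| ^ p ∂(riemVolume g)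

/-- `f` belongs to `W_0^{1,p}(Ω)`, the closure of `C_c^∞(Ω)` for the norm
`‖u‖_{1,p}^p = ∫_Ω |u|^p + ∫_Ω ‖∇u‖^p`, and its gradient is `V`: the function `f` and the vector
field `V` are measurable, `p`-integrable, and there are test functions `φₖ` with
`∫_Ω |φₖ - f|^p + ∫_Ω ‖∇φₖ - V‖^p → 0`. -/
structure IsSobolevZero (g : Metric n M) [MeasurableSpace M] (p : ℝ) (Ω : Set M)
    (f : M → ℝ) (V : VField n M) : Prop where
  measurable_fun : AEStronglyMeasurable f ((riemVolume g).restrict Ω)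
  measurable_grad : AEStronglyMeasurable
    (fun x => (⟨x, V x⟩ : TangentBundle (𝓡 n) M)) ((riemVolume g).restrict Ω)
  mass_lt_top : mass g p Ω f < (⊤ : ℝ≥0∞)
  energy_lt_top : energy g p Ω V < (⊤ : ℝ≥0∞)
  approx : ∃ φ : ℕ → M → ℝ, (∀ k, IsTestFunction n Ω (φ k)) ∧
    Filter.Tendsto
      (fun k => mass g p Ω (fun x => φ k x - f x) + energy g p Ω (fun x => grad g (φ k) x - V x))
      Filter.atTop (nhds 0)

/-- The `p`-fundamental tone
`μ_p^*(Ω) = inf { ∫_Ω ‖∇f‖^p / ∫_Ω |f|^p : f ∈ W_0^{1,p}(Ω), f ≠ 0 }`. -/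
def fundamentalTone (g : Metric n M) [MeasurableSpace M] (p : ℝ) (Ω : Set M) : ℝ≥0∞ :=
  ⨅ (f : M → ℝ) (V : VField n M) (_ : IsSobolevZero g p Ω f V)
    (_ : ¬ f =ᵐ[(riemVolume g).restrict Ω] 0), energy g p Ω V / mass g p Ω f

/-- The class `𝔛(Ω)`: vector fields, smooth on `Ω`, with `sup_Ω ‖X‖ < ∞` and `inf_Ω div X > 0`.
Values outside `Ω` play no role. -/
structure IsAdmissible (g : Metric n M) (Ω : Set M) (X : VField n M) : Prop where
  smooth : ContMDiffOn (𝓡 n) (𝓡 n).tangent ∞ (fun x => (⟨x, X x⟩ : TangentBundle (𝓡 n) M)) Ω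
  bounded : ∃ C : ℝ, ∀ x ∈ Ω, vnorm g (X x) ≤ C
  div_pos : ∃ δ : ℝ, 0 < δ ∧ ∀ x ∈ Ω, δ ≤ divergence g X x

/-- The constant `c(Ω) = sup { inf_Ω div X / sup_Ω ‖X‖ : X ∈ 𝔛(Ω) }`. -/
def cConst (g : Metric n M) (Ω : Set M) : ℝ≥0∞ :=
  ⨆ (X : VField n M) (_ : IsAdmissible g Ω X),
    (⨅ x ∈ Ω, ENNReal.ofReal (divergence g X x)) / (⨆ x ∈ Ω, ENNReal.ofReal (vnorm g (X x)))

end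

end PTone

end

noncomputable section

namespace PTone

/-! ### Derivative of the determinant and the Piola identity -/

section Piola

variable {E : Type*} [NormedAddCommGroup E] [NormedSpace ℝ E] [FiniteDimensional ℝ E]

/-! Lower bound. Let `div X ≥ a > 0` and `‖X‖ ≤ B` on `Ω`, and let `φ` be a test function. Since `p
> 1`, the function `|φ|^p` is C¹ with compact support in `Ω`, so `div(|φ|^p X)` integrates to zero
(`integral_divSMul_eq_zero`). Pointwise, `a|φ|^p ≤ p|φ|^(p-1) ‖∇φ‖ B + div(|φ|^p X)`, and Young's
inequality turns this into `|φ|^p - (p/a) div(|φ|^p X) ≤ (pB/a)^p ‖∇φ‖^p` (`rpow_le_of_le_young`).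
Integrating, and passing to the limit in `W₀^{1,p}` (`mass_le_energy`), bounds every Rayleigh
quotient below by `(a/(pB))^p`; the supremum over `X` gives the claim.

Positivity. One admissible field is enough. Consider the points of `M` near which some bounded
smooth field on `Ω` has divergence bounded below by a positive constant, while its divergence is
nonnegative on all of `Ω`. These points form an open set. The set is also closed: a radial field of
Hopf type contracts only near its centre, and a multiple of a field that already expands there
compensates the loss (`exists_nhds_hasExpandingField_of_mem_closure`). It meets the component of
`Ω`, because a radial field centred on one side of a hypersurface outside `Ω` can be kept on the
other side and replaced by zero elsewhere without losing smoothness on `Ω`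
(`exists_hasExpandingField_of_hypersurface`). So it contains `closure Ω`, and by compactness a
finite sum of such fields is admissible.

Both halves need the divergence and the volume in arbitrary charts, whereas the definitions use the
preferred chart at each point and a supremum of chart measures. Chart independence is
`divergence_eq`, resting on the Piola identity, and `riemVolume_eq_chartVolume`. -/

theorem differentiable_det : Differentiable ℝ (fun A : E →L[ℝ] E => A.det) := by
  classical
  let b := Module.finBasis ℝ E
  have h : (fun A : E →L[ℝ] E => A.det) = fun A => ∑ σ : Equiv.Perm (Fin (Module.finrank ℝ E)),
      ((Equiv.Perm.sign σ : ℤ) : ℝ) * ∏ i, b.repr (A (b i)) (σ i) := by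
    funext A
    change LinearMap.det (A : E →ₗ[ℝ] E) = _
    rw [← LinearMap.det_toMatrix b, Matrix.det_apply']
    simp [LinearMap.toMatrix_apply]
  rw [h]
  have h2 : ∀ i j, Differentiable ℝ (fun A : E →L[ℝ] E => b.repr (A (b i)) j) := by
    intro i j
    let L : (E →L[ℝ] E) →ₗ[ℝ] ℝ :=
      (b.coord j) ∘ₗ (ContinuousLinearMap.apply ℝ E (b i)).toLinearMap
    exact (LinearMap.toContinuousLinearMap L).differentiable
  refine Differentiable.fun_sum fun σ _ => ?_
  refine (differentiable_const _).mul ?_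
  exact fun A => (HasFDerivAt.finsetProd fun i _ => (h2 i (σ i) A).hasFDerivAt).differentiableAt

/-- Jacobi's formula: `det(A + tH) = det A · det(1 + tBH)`, and the second factor is a polynomial `1
+ t tr(BH) + O(t²)`. -/
theorem fderiv_det_apply (A B H : E →L[ℝ] E) (hAB : A ∘L B = .id ℝ E) :
    fderiv ℝ (fun A : E →L[ℝ] E => A.det) A H =
      A.det * LinearMap.trace ℝ E (B ∘L H : E →L[ℝ] E) := by
  classical
  let b := Module.finBasis ℝ E
  let N : Matrix _ _ ℝ := LinearMap.toMatrix b b (B ∘L H : E →L[ℝ] E)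
  have key : ∀ t : ℝ, (A + t • H).det = A.det * (1 + Matrix.trace N * t +
      (Matrix.det (1 + (Polynomial.X : Polynomial ℝ) •
        N.map Polynomial.C)).divX.divX.eval t * t ^ 2) := by
    intro t
    have e1 : A + t • H = A ∘L (.id ℝ E + t • (B ∘L H)) := by
      ext v
      have := congrArg (fun L : E →L[ℝ] E => L (H v)) hAB
      simp at this
      simp [this]
    have e2 : (A + t • H).det =
        A.det * LinearMap.det ((.id ℝ E + t • (B ∘L H) : E →L[ℝ] E) : E →ₗ[ℝ] E) := by
      rw [e1]
      exact LinearMap.det_comp _ _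
    rw [e2, ← LinearMap.det_toMatrix b, ← Matrix.det_one_add_smul]
    congr 2
    have : ((.id ℝ E + t • (B ∘L H) : E →L[ℝ] E) : E →ₗ[ℝ] E) =
      LinearMap.id + t • ((B ∘L H : E →L[ℝ] E) : E →ₗ[ℝ] E) := rfl
    rw [this, map_add, map_smul, LinearMap.toMatrix_id]
  have hd := (differentiable_det (E := E) A).hasFDerivAt.hasLineDerivAt H
  have hd' : HasLineDerivAt ℝ (fun A : E →L[ℝ] E => A.det)
      (A.det * LinearMap.trace ℝ E (B ∘L H : E →L[ℝ] E)) A H := by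
    have : LinearMap.trace ℝ E (B ∘L H : E →L[ℝ] E) = Matrix.trace N :=
      LinearMap.trace_eq_matrix_trace ℝ b _
    rw [this]
    unfold HasLineDerivAt
    simp only [key]
    set P := (Matrix.det (1 + (Polynomial.X : Polynomial ℝ) •
        N.map Polynomial.C)).divX.divX
    have h1 : HasDerivAt (fun t : ℝ => A.det * (1 + N.trace * t + P.eval t * t ^ 2))
      (A.det * (N.trace * 1 + (P.derivative.eval 0 * (0:ℝ) ^ 2 + P.eval 0 * (2 * 0)))) 0 := by
      refine HasDerivAt.const_mul _ ?_
      refine HasDerivAt.add (HasDerivAt.const_add _ ((hasDerivAt_id _).const_mul _)) ?_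
      refine (P.hasDerivAt 0).mul ?_
      simpa using hasDerivAt_pow 2 (0:ℝ)
    simpa using h1
  exact HasDerivAt.unique hd hd'

/-- The Piola identity: the divergence of the pulled back density `|det Dτ| (Dτ)⁻¹ W ∘ τ`. -/
theorem trace_fderiv_pullback {τ u W : E → E} {y : E} (hτ : ContDiffAt ℝ 2 τ y)
    (B : E →L[ℝ] E) (hBA : B ∘L fderiv ℝ τ y = .id ℝ E) (hAB : fderiv ℝ τ y ∘L B = .id ℝ E)
    (hu : DifferentiableAt ℝ u y) (hW : DifferentiableAt ℝ W (τ y))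
    (heq : ∀ᶠ z in nhds y, fderiv ℝ τ z (u z) = W (τ z)) :
    LinearMap.trace ℝ E (fderiv ℝ (fun z => |(fderiv ℝ τ z).det| • u z) y : E →L[ℝ] E) =
      |(fderiv ℝ τ y).det| * LinearMap.trace ℝ E (fderiv ℝ W (τ y) : E →L[ℝ] E) := by
  set A := fderiv ℝ τ y with hA
  have hA' : DifferentiableAt ℝ (fderiv ℝ τ) y :=
    (hτ.fderiv_right (m := 1) (by norm_num)).differentiableAt (by norm_num)
  set D2 := fderiv ℝ (fderiv ℝ τ) y with hD2
  have hsymm : ∀ v w, D2 v w = D2 w v := (hτ.isSymmSndFDerivAt (by simp)).eq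
  have hdet : A.det ≠ 0 := by
    intro h0
    have h1 : LinearMap.det ((A ∘L B : E →L[ℝ] E) : E →ₗ[ℝ] E) = 1 := by
      rw [hAB]; exact LinearMap.det_id
    have h2 : LinearMap.det ((A ∘L B : E →L[ℝ] E) : E →ₗ[ℝ] E) = A.det * B.det :=
      LinearMap.det_comp _ _
    rw [h2, h0, zero_mul] at h1
    exact zero_ne_one h1
  have hd : HasFDerivAt (fun z => (fderiv ℝ τ z).det)
      ((fderiv ℝ (fun A : E →L[ℝ] E => A.det) A) ∘L D2) y :=
    (differentiable_det A).hasFDerivAt.comp y hA'.hasFDerivAt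
  set σ : ℝ := ((SignType.sign A.det : SignType) : ℝ) with hσ
  have habs : HasFDerivAt (fun z => |(fderiv ℝ τ z).det|)
      (σ • ((fderiv ℝ (fun A : E →L[ℝ] E => A.det) A) ∘L D2)) y := by
    exact (hasDerivAt_abs hdet).comp_hasFDerivAt y hd
  have hmain := habs.smul hu.hasFDerivAt
  have hdiff : ∀ h, D2 h (u y) + A (fderiv ℝ u y h) = fderiv ℝ W (τ y) (A h) := by
    intro h
    have h1 := hA'.hasFDerivAt.clm_apply hu.hasFDerivAt
    have h2 := hW.hasFDerivAt.comp y (hτ.differentiableAt (by norm_num)).hasFDerivAt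
    have h3 := h1.unique (h2.congr_of_eventuallyEq heq)
    have h4 := congrArg (fun L : E →L[ℝ] E => L h) h3
    simpa [add_comm] using h4
  have hBAv : ∀ v, B (A v) = v := fun v => congrArg (fun L : E →L[ℝ] E => L v) hBA
  -- Solve the differentiated relation `Dτ u = W ∘ τ` for `Du`. Symmetry of the second derivative
  -- rewrites the correction as `B ∘ D²τ(u)`, whose trace is cancelled by the derivative of the
  -- determinant.
  have hDu : fderiv ℝ u y = B ∘L (fderiv ℝ W (τ y) ∘L A) - B ∘L (D2 (u y)) := by
    ext h
    have := congrArg B (hdiff h)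
    rw [map_add, hBAv] at this
    simp only [sub_apply, ContinuousLinearMap.comp_apply]
    rw [← this, hsymm h (u y)]
    abel
  have hmain' := hmain.fderiv
  change fderiv ℝ (fun z => |(fderiv ℝ τ z).det| • u z) y = _ at hmain'
  rw [hmain']
  have htr : LinearMap.trace ℝ E ((B ∘L (fderiv ℝ W (τ y) ∘L A) : E →L[ℝ] E) : E →ₗ[ℝ] E) =
      LinearMap.trace ℝ E (fderiv ℝ W (τ y) : E →L[ℝ] E) := by
    have h1 : ((B ∘L (fderiv ℝ W (τ y) ∘L A) : E →L[ℝ] E) : E →ₗ[ℝ] E) =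
      (B : E →ₗ[ℝ] E) * (((fderiv ℝ W (τ y)) : E →ₗ[ℝ] E) * (A : E →ₗ[ℝ] E)) := rfl
    have h2 : (A : E →ₗ[ℝ] E) * (B : E →ₗ[ℝ] E) = 1 := by
      ext v
      exact congrArg (fun L : E →L[ℝ] E => L v) hAB
    rw [h1, LinearMap.trace_mul_comm, mul_assoc, h2, mul_one]
  have hσabs : σ * A.det = |A.det| := by
    rw [hσ]; exact sign_mul_self A.det
  have hsplit : LinearMap.trace ℝ E ((|A.det| • fderiv ℝ u y +
      (σ • ((fderiv ℝ (fun A : E →L[ℝ] E => A.det) A) ∘L D2)).smulRight (u y) : E →L[ℝ] E) :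
        E →ₗ[ℝ] E) = |A.det| * LinearMap.trace ℝ E (fderiv ℝ u y : E →ₗ[ℝ] E) +
      σ * fderiv ℝ (fun A : E →L[ℝ] E => A.det) A (D2 (u y)) := by
    rw [ContinuousLinearMap.toLinearMap_add, map_add, ContinuousLinearMap.toLinearMap_smul, map_smul]
    congr 1
    exact LinearMap.trace_smulRight _ _
  rw [hsplit, fderiv_det_apply A B _ hAB, hDu, ContinuousLinearMap.toLinearMap_sub, map_sub, htr,
    ← mul_assoc, hσabs]
  ring

end Piola

/-! ### Metric, density and divergence in arbitrary charts -/

section Charts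

variable {n : ℕ} {M : Type*} [TopologicalSpace M] [ChartedSpace (EuclideanSpace ℝ (Fin n)) M]

/-- The derivative of a chart. -/
def dchart (e : OpenPartialHomeomorph M (EuclideanSpace ℝ (Fin n))) (x : M) :
    TangentSpace (𝓡 n) x →L[ℝ] EuclideanSpace ℝ (Fin n) :=
  mfderiv (𝓡 n) (𝓡 n) e x

/-- The inverse of the derivative of a chart: the coordinate frame. -/
def frame (e : OpenPartialHomeomorph M (EuclideanSpace ℝ (Fin n))) (x : M) :
    EuclideanSpace ℝ (Fin n) →L[ℝ] TangentSpace (𝓡 n) x :=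
  (dchart e x).inverse

/-- The components of a vector field in a chart, as a function of the coordinates. -/
def chartComp (e : OpenPartialHomeomorph M (EuclideanSpace ℝ (Fin n))) (X : VField n M)
    (y : EuclideanSpace ℝ (Fin n)) : EuclideanSpace ℝ (Fin n) :=
  dchart e (e.symm y) (X (e.symm y))

variable {e e' : OpenPartialHomeomorph M (EuclideanSpace ℝ (Fin n))}

theorem mdifferentiable_of_mem (he : e ∈ IsManifold.maximalAtlas (𝓡 n) ∞ M) :
    e.MDifferentiable (𝓡 n) (𝓡 n) :=
  ⟨(contMDiffOn_of_mem_maximalAtlas he).mdifferentiableOn (by simp),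
    (contMDiffOn_symm_of_mem_maximalAtlas he).mdifferentiableOn (by simp)⟩

theorem contDiffAt_transition (he : e ∈ IsManifold.maximalAtlas (𝓡 n) ∞ M)
    (he' : e' ∈ IsManifold.maximalAtlas (𝓡 n) ∞ M) {x : M} (hx : x ∈ e.source)
    (hx' : x ∈ e'.source) : ContDiffAt ℝ ∞ (e' ∘ e.symm) (e x) := by
  rw [← contMDiffAt_iff_contDiffAt]
  refine ContMDiffAt.comp (I' := 𝓡 n) _ ?_ (contMDiffAt_symm_of_mem_maximalAtlas he (e.map_source hx))
  rw [e.left_inv hx]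
  exact contMDiffAt_of_mem_maximalAtlas he' hx'

theorem dchart_isInvertible (he : e ∈ IsManifold.maximalAtlas (𝓡 n) ∞ M) {x : M}
    (hx : x ∈ e.source) : (dchart e x).IsInvertible :=
  ⟨(mdifferentiable_of_mem he).mfderiv hx, rfl⟩

theorem frame_dchart (he : e ∈ IsManifold.maximalAtlas (𝓡 n) ∞ M) {x : M}
    (hx : x ∈ e.source) (v : TangentSpace (𝓡 n) x) : frame e x (dchart e x v) = v :=
  (dchart_isInvertible he hx).inverse_apply_self v

theorem dchart_frame (he : e ∈ IsManifold.maximalAtlas (𝓡 n) ∞ M) {x : M}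
    (hx : x ∈ e.source) (v : EuclideanSpace ℝ (Fin n)) : dchart e x (frame e x v) = v :=
  (dchart_isInvertible he hx).self_apply_inverse v

theorem mfderiv_symm_eq_frame (he : e ∈ IsManifold.maximalAtlas (𝓡 n) ∞ M)
    {y : EuclideanSpace ℝ (Fin n)} (hy : y ∈ e.target) (v : EuclideanSpace ℝ (Fin n)) :
    (mfderiv (𝓡 n) (𝓡 n) e.symm y v : TangentSpace (𝓡 n) (e.symm y)) = frame e (e.symm y) v := by
  have h := (mdifferentiable_of_mem he).comp_symm_deriv hy
  have h1 : dchart e (e.symm y) (mfderiv (𝓡 n) (𝓡 n) e.symm y v) = v :=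
    congrArg (fun L : EuclideanSpace ℝ (Fin n) →L[ℝ] EuclideanSpace ℝ (Fin n) => L v) h
  rw [← frame_dchart he (e.map_target hy) (mfderiv (𝓡 n) (𝓡 n) e.symm y v), h1]

theorem fderiv_transition_dchart (he : e ∈ IsManifold.maximalAtlas (𝓡 n) ∞ M)
    (he' : e' ∈ IsManifold.maximalAtlas (𝓡 n) ∞ M) {x : M} (hx : x ∈ e.source)
    (hx' : x ∈ e'.source) (v : TangentSpace (𝓡 n) x) :
    fderiv ℝ (e' ∘ e.symm) (e x) (dchart e x v) = dchart e' x v := by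
  have h1 : HasMFDerivAt (𝓡 n) (𝓡 n) e x (dchart e x) :=
    ((mdifferentiable_of_mem he).mdifferentiableAt hx).hasMFDerivAt
  have h2 : HasMFDerivAt (𝓡 n) (𝓡 n) (e' ∘ e.symm) (e x) (fderiv ℝ (e' ∘ e.symm) (e x)) :=
    (((contDiffAt_transition he he' hx hx').differentiableAt (by simp)).hasFDerivAt).hasMFDerivAt
  have h3 := h2.comp x h1
  have h4 : HasMFDerivAt (𝓡 n) (𝓡 n) e' x (dchart e' x) :=
    ((mdifferentiable_of_mem he').mdifferentiableAt hx').hasMFDerivAt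
  have h5 : (e' ∘ e.symm) ∘ e =ᶠ[nhds x] e' := by
    filter_upwards [e.open_source.mem_nhds hx] with z hz
    simp [e.left_inv hz]
  have h6 := hasMFDerivAt_unique (h3.congr_of_eventuallyEq h5.symm) h4
  exact congrArg (fun L : EuclideanSpace ℝ (Fin n) →L[ℝ] EuclideanSpace ℝ (Fin n) => L v) h6

theorem frame_fderiv_transition (he : e ∈ IsManifold.maximalAtlas (𝓡 n) ∞ M)
    (he' : e' ∈ IsManifold.maximalAtlas (𝓡 n) ∞ M) {x : M} (hx : x ∈ e.source)
    (hx' : x ∈ e'.source) (v : EuclideanSpace ℝ (Fin n)) :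
    frame e x v = frame e' x (fderiv ℝ (e' ∘ e.symm) (e x) v) := by
  conv_rhs => rw [← dchart_frame he hx v]
  rw [fderiv_transition_dchart he he' hx hx', frame_dchart he' hx']

theorem fderiv_transition_comp (he : e ∈ IsManifold.maximalAtlas (𝓡 n) ∞ M)
    (he' : e' ∈ IsManifold.maximalAtlas (𝓡 n) ∞ M) {x : M} (hx : x ∈ e.source)
    (hx' : x ∈ e'.source) :
    fderiv ℝ (e' ∘ e.symm) (e x) ∘L fderiv ℝ (e ∘ e'.symm) (e' x) = .id ℝ _ := by
  ext1 v
  change fderiv ℝ (e' ∘ e.symm) (e x) (fderiv ℝ (e ∘ e'.symm) (e' x) v) = v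
  rw [← dchart_frame he' hx' v, fderiv_transition_dchart he' he hx' hx,
    fderiv_transition_dchart he he' hx hx']

variable [IsManifold (𝓡 n) ∞ M]

/-- The coefficients of the metric in a chart. -/
def gram (g : Metric n M) (e : OpenPartialHomeomorph M (EuclideanSpace ℝ (Fin n))) (x : M) :
    Matrix (Fin n) (Fin n) ℝ :=
  Matrix.of fun i j => g.inner x (frame e x (EuclideanSpace.single i 1))
    (frame e x (EuclideanSpace.single j 1))

/-- The Riemannian density of a chart. -/
def volDens (g : Metric n M) (e : OpenPartialHomeomorph M (EuclideanSpace ℝ (Fin n))) (x : M) : ℝ :=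
  Real.sqrt (gram g e x).det

/-- The coordinate expression of a vector field in a chart, times the Riemannian density. -/
def weightedComp (g : Metric n M) (e : OpenPartialHomeomorph M (EuclideanSpace ℝ (Fin n)))
    (X : VField n M) (y : EuclideanSpace ℝ (Fin n)) : EuclideanSpace ℝ (Fin n) :=
  volDens g e (e.symm y) • chartComp e X y

theorem density_eq (g : Metric n M) (x : M) {y : EuclideanSpace ℝ (Fin n)}
    (hy : y ∈ (chartAt (EuclideanSpace ℝ (Fin n)) x).target) :
    density g x y = volDens g (chartAt _ x) ((chartAt (EuclideanSpace ℝ (Fin n)) x).symm y) := by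
  unfold density volDens gram
  have h : ∀ i, coordVec x i y =
      frame (chartAt _ x) ((chartAt (EuclideanSpace ℝ (Fin n)) x).symm y)
        (EuclideanSpace.single i 1) :=
    fun i => mfderiv_symm_eq_frame (IsManifold.chart_mem_maximalAtlas x) hy _
  simp_rw [h]
  rfl

/-- If `N` is the matrix of `A`, the Gram matrix of the transformed frame is `Nᵀ G N`. -/
theorem det_gram_comp {V : Type*} [AddCommGroup V] [Module ℝ V]
    (β : V → V → ℝ) (hl : ∀ w, IsLinearMap ℝ fun v => β v w) (hr : ∀ v, IsLinearMap ℝ (β v))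
    (P : EuclideanSpace ℝ (Fin n) →ₗ[ℝ] V)
    (A : EuclideanSpace ℝ (Fin n) →ₗ[ℝ] EuclideanSpace ℝ (Fin n)) :
    (Matrix.of fun i j : Fin n => β (P (A (EuclideanSpace.single i 1)))
      (P (A (EuclideanSpace.single j 1)))).det = LinearMap.det A ^ 2 *
    (Matrix.of fun i j : Fin n => β (P (EuclideanSpace.single i 1))
      (P (EuclideanSpace.single j 1))).det := by
  let b := (EuclideanSpace.basisFun (Fin n) ℝ).toBasis
  let N := LinearMap.toMatrix b b A
  have hA : ∀ i, P (A (EuclideanSpace.single i 1)) =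
      ∑ k, N k i • P (EuclideanSpace.single k 1) := by
    intro i
    rw [← (EuclideanSpace.basisFun (Fin n) ℝ).sum_repr (A (EuclideanSpace.single i 1)), map_sum]
    refine Finset.sum_congr rfl fun k _ => ?_
    rw [map_smul]
    simp [N, b, LinearMap.toMatrix_apply]
  have hmat : (Matrix.of fun i j : Fin n => β (P (A (EuclideanSpace.single i 1)))
      (P (A (EuclideanSpace.single j 1)))) = N.transpose *
      (Matrix.of fun i j : Fin n => β (P (EuclideanSpace.single i 1))
      (P (EuclideanSpace.single j 1))) * N := by
    ext i j
    have hl' : ∀ w, β (∑ k, N k i • P (EuclideanSpace.single k 1)) w =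
        ∑ k, N k i * β (P (EuclideanSpace.single k 1)) w := by
      intro w
      have := map_sum (IsLinearMap.mk' _ (hl w)) (fun k => N k i • P (EuclideanSpace.single k 1))
        Finset.univ
      simp only [map_smul, IsLinearMap.mk'_apply, smul_eq_mul] at this
      exact this
    have hr' : ∀ v, β v (∑ k, N k j • P (EuclideanSpace.single k 1)) =
        ∑ k, N k j * β v (P (EuclideanSpace.single k 1)) := by
      intro v
      have := map_sum (IsLinearMap.mk' _ (hr v)) (fun k => N k j • P (EuclideanSpace.single k 1))
        Finset.univ
      simp only [map_smul, IsLinearMap.mk'_apply, smul_eq_mul] at this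
      exact this
    simp only [Matrix.of_apply, hA, hl', hr', Matrix.mul_apply, Matrix.transpose_apply,
      Finset.mul_sum, Finset.sum_mul]
    rw [Finset.sum_comm]
    refine Finset.sum_congr rfl fun k _ => Finset.sum_congr rfl fun l _ => ?_
    ring
  rw [hmat, Matrix.det_mul, Matrix.det_mul, Matrix.det_transpose, LinearMap.det_toMatrix]
  ring

/-- The factor `|det Dτ|` is the one that occurs both in the change of variables for the volume and
in the Piola identity for the divergence. -/
theorem volDens_transition (g : Metric n M) (he : e ∈ IsManifold.maximalAtlas (𝓡 n) ∞ M)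
    (he' : e' ∈ IsManifold.maximalAtlas (𝓡 n) ∞ M) {x : M} (hx : x ∈ e.source)
    (hx' : x ∈ e'.source) :
    volDens g e x = |(fderiv ℝ (e' ∘ e.symm) (e x)).det| * volDens g e' x := by
  unfold volDens gram
  simp_rw [frame_fderiv_transition he he' hx hx']
  have := det_gram_comp (fun v w => g.inner x v w)
    (fun w => ⟨fun a b => by simp, fun c a => by simp⟩)
    (fun v => ⟨fun a b => by simp, fun c a => by simp⟩)
    (frame e' x).toLinearMap (fderiv ℝ (e' ∘ e.symm) (e x)).toLinearMap
  simp only [ContinuousLinearMap.coe_coe] at this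
  rw [this, Real.sqrt_mul (sq_nonneg _), Real.sqrt_sq_eq_abs]

/-- The Gram matrix represents the quadratic form `v ↦ g(∑ vᵢ∂ᵢ, ∑ vⱼ∂ⱼ)`, which is positive
definite because the frame is injective. -/
theorem gram_det_pos (g : Metric n M) (he : e ∈ IsManifold.maximalAtlas (𝓡 n) ∞ M) {x : M}
    (hx : x ∈ e.source) : 0 < (gram g e x).det := by
  refine Matrix.PosDef.det_pos (Matrix.PosDef.of_dotProduct_mulVec_pos ?_ ?_)
  · ext i j
    simp [gram, g.symm x]
  · intro v hv
    let w : EuclideanSpace ℝ (Fin n) := WithLp.toLp 2 v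
    have hw : frame e x w = ∑ i, v i • frame e x (EuclideanSpace.single i 1) := by
      rw [← (EuclideanSpace.basisFun (Fin n) ℝ).sum_repr w, map_sum]
      simp [w]
    have h0 : frame e x w ≠ 0 := by
      intro h0
      have := dchart_frame he hx w
      rw [h0, map_zero] at this
      exact hv (by simpa [w] using this.symm)
    have := g.pos x _ h0
    rw [hw] at this
    refine lt_of_lt_of_eq this (Eq.symm ?_)
    simp only [map_sum, sum_apply, map_smul, smul_apply, gram,
      dotProduct, Matrix.mulVec, Matrix.of_apply, smul_eq_mul, star_trivial, Finset.mul_sum]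
    refine Finset.sum_comm.trans ?_
    refine Finset.sum_congr rfl fun i _ => Finset.sum_congr rfl fun j _ => ?_
    ring

theorem volDens_pos (g : Metric n M) (he : e ∈ IsManifold.maximalAtlas (𝓡 n) ∞ M) {x : M}
    (hx : x ∈ e.source) : 0 < volDens g e x :=
  Real.sqrt_pos.2 (gram_det_pos g he hx)

theorem contMDiffAt_frame (he : e ∈ IsManifold.maximalAtlas (𝓡 n) ∞ M) {x : M}
    (hx : x ∈ e.source) {V : EuclideanSpace ℝ (Fin n) → EuclideanSpace ℝ (Fin n)}
    (hV : ContDiffAt ℝ ∞ V (e x)) :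
    ContMDiffAt (𝓡 n) (𝓡 n).tangent ∞
      (fun z => (⟨z, frame e z (V (e z))⟩ : TangentBundle (𝓡 n) M)) x := by
  have : IsManifold (𝓡 n) 1 M := IsManifold.of_le (n := ∞) (by simp)
  exact ContMDiffAt.mpullback_vectorField_preimage (I := 𝓡 n) (I' := 𝓡 n) (f := e) (V := V)
    (n := ∞)
    (contMDiffAt_vectorSpace_iff_contDiffAt.2 hV) (contMDiffAt_of_mem_maximalAtlas he hx)
    (dchart_isInvertible he hx) (by simp)

theorem contDiffAt_chartComp (he : e ∈ IsManifold.maximalAtlas (𝓡 n) ∞ M) {x : M}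
    (hx : x ∈ e.source) {X : VField n M}
    (hX : ContMDiffAt (𝓡 n) (𝓡 n).tangent ∞ (fun x => (⟨x, X x⟩ : TangentBundle (𝓡 n) M)) x) :
    ContDiffAt ℝ ∞ (chartComp e X) (e x) := by
  have : IsManifold (𝓡 n) 1 M := IsManifold.of_le (n := ∞) (by simp)
  have hm : ∀ y ∈ e.target, (mfderiv (𝓡 n) (𝓡 n) e.symm y).IsInvertible := fun y hy =>
    ⟨(mdifferentiable_of_mem he).symm.mfderiv hy, rfl⟩
  have h := ContMDiffAt.mpullback_vectorField_preimage (I := 𝓡 n) (I' := 𝓡 n) (f := e.symm)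
    (V := X) (n := ∞) (m := ∞) (x₀ := e x) (by rwa [e.left_inv hx])
    (contMDiffAt_symm_of_mem_maximalAtlas he (e.map_source hx)) (hm _ (e.map_source hx)) (by simp)
  have h2 := contMDiffAt_vectorSpace_iff_contDiffAt.1 h
  refine h2.congr_of_eventuallyEq ?_
  filter_upwards [e.open_target.mem_nhds (e.map_source hx)] with y hy
  have h3 := mfderiv_symm_eq_frame he hy (chartComp e X y)
  unfold chartComp at h3
  rw [frame_dchart he (e.map_target hy)] at h3
  change chartComp e X y = (mfderiv (𝓡 n) (𝓡 n) e.symm y).inverse (X (e.symm y))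
  conv_rhs => rw [← h3]
  exact ((hm y hy).inverse_apply_self _).symm

theorem contMDiffAt_inner (g : Metric n M) {X Y : VField n M} {x : M}
    (hX : ContMDiffAt (𝓡 n) (𝓡 n).tangent ∞ (fun x => (⟨x, X x⟩ : TangentBundle (𝓡 n) M)) x)
    (hY : ContMDiffAt (𝓡 n) (𝓡 n).tangent ∞ (fun x => (⟨x, Y x⟩ : TangentBundle (𝓡 n) M)) x) :
    ContMDiffAt (𝓡 n) 𝓘(ℝ, ℝ) ∞ (fun x => g.inner x (X x) (Y x)) x := by
  have h := ContMDiffAt.clm_bundle_apply₂ (F₁ := EuclideanSpace ℝ (Fin n))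
    (F₂ := EuclideanSpace ℝ (Fin n)) (F₃ := ℝ) (E₁ := fun x : M => TangentSpace (𝓡 n) x)
    (E₂ := fun x : M => TangentSpace (𝓡 n) x) (E₃ := Bundle.Trivial M ℝ) (b := fun x => x)
    (ψ := g.inner) (v := X) (w := Y) (g.contMDiff x) hX hY
  rw [contMDiffAt_totalSpace] at h
  exact h.2

theorem contDiffAt_volDens (g : Metric n M) (he : e ∈ IsManifold.maximalAtlas (𝓡 n) ∞ M) {x : M}
    (hx : x ∈ e.source) : ContDiffAt ℝ ∞ (fun y => volDens g e (e.symm y)) (e x) := by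
  unfold volDens
  refine ContDiffAt.sqrt ?_ (by rw [e.left_inv hx]; exact (gram_det_pos g he hx).ne')
  simp_rw [Matrix.det_apply']
  refine ContDiffAt.sum fun σ _ => contDiffAt_const.mul (contDiffAt_prod fun i _ => ?_)
  rw [← contMDiffAt_iff_contDiffAt]
  refine ContMDiffAt.comp (I' := 𝓡 n) (g := fun x => gram g e x (σ i) i) _ ?_
    (contMDiffAt_symm_of_mem_maximalAtlas he (e.map_source hx))
  rw [e.left_inv hx]
  exact contMDiffAt_inner g (contMDiffAt_frame he hx contDiffAt_const)
    (contMDiffAt_frame he hx contDiffAt_const)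

theorem contDiffAt_weightedComp (g : Metric n M) (he : e ∈ IsManifold.maximalAtlas (𝓡 n) ∞ M)
    {x : M} (hx : x ∈ e.source) {X : VField n M}
    (hX : ContMDiffAt (𝓡 n) (𝓡 n).tangent ∞ (fun x => (⟨x, X x⟩ : TangentBundle (𝓡 n) M)) x) :
    ContDiffAt ℝ ∞ (weightedComp g e X) (e x) :=
  (contDiffAt_volDens g he hx).smul (contDiffAt_chartComp he hx hX)

theorem trace_eq_sum_single (L : EuclideanSpace ℝ (Fin n) →L[ℝ] EuclideanSpace ℝ (Fin n)) :
    LinearMap.trace ℝ _ (L : EuclideanSpace ℝ (Fin n) →ₗ[ℝ] EuclideanSpace ℝ (Fin n)) =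
      ∑ i, L (EuclideanSpace.single i 1) i := by
  rw [LinearMap.trace_eq_sum_inner _ (EuclideanSpace.basisFun (Fin n) ℝ)]
  simp [EuclideanSpace.inner_single_left]

theorem divergence_eq_chartAt (g : Metric n M) {X : VField n M} {x : M}
    (hX : ContMDiffAt (𝓡 n) (𝓡 n).tangent ∞ (fun x => (⟨x, X x⟩ : TangentBundle (𝓡 n) M)) x) :
    divergence g X x = (volDens g (chartAt _ x) x)⁻¹ * LinearMap.trace ℝ _
      (fderiv ℝ (weightedComp g (chartAt _ x) X) (chartAt (EuclideanSpace ℝ (Fin n)) x x) :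
        EuclideanSpace ℝ (Fin n) →ₗ[ℝ] EuclideanSpace ℝ (Fin n)) := by
  set e := chartAt (EuclideanSpace ℝ (Fin n)) x
  have he : e ∈ IsManifold.maximalAtlas (𝓡 n) ∞ M := IsManifold.chart_mem_maximalAtlas x
  have hx : x ∈ e.source := mem_chart_source _ x
  unfold divergence
  have h1 : density g x (e x) = volDens g e x := by
    rw [density_eq g x (e.map_source hx), e.left_inv hx]
  change (density g x (e x))⁻¹ * ∑ i, fderiv ℝ (fun y => density g x y * coordComp X x i y) (e x)
    (EuclideanSpace.single i (1 : ℝ)) = _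
  rw [h1, trace_eq_sum_single]
  congr 1
  refine Finset.sum_congr rfl fun i _ => ?_
  have hW := (contDiffAt_weightedComp g he hx hX).differentiableAt (by simp)
  have h2 : (fun y => density g x y * coordComp X x i y) =ᶠ[nhds (e x)]
      fun y => EuclideanSpace.proj i (weightedComp g e X y) := by
    filter_upwards [e.open_target.mem_nhds (e.map_source hx)] with y hy
    rw [density_eq g x hy]
    rfl
  rw [h2.fderiv_eq]
  have h3 := (EuclideanSpace.proj (𝕜 := ℝ) i).hasFDerivAt.comp (e x) hW.hasFDerivAt
  exact congrArg (fun L : EuclideanSpace ℝ (Fin n) →L[ℝ] ℝ => L (EuclideanSpace.single i 1))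
    h3.fderiv

/-- The divergence in an arbitrary chart of the smooth structure. -/
theorem divergence_eq (g : Metric n M) (he : e ∈ IsManifold.maximalAtlas (𝓡 n) ∞ M)
    {x : M} (hx : x ∈ e.source) {X : VField n M}
    (hX : ContMDiffAt (𝓡 n) (𝓡 n).tangent ∞ (fun x => (⟨x, X x⟩ : TangentBundle (𝓡 n) M)) x) :
    divergence g X x = (volDens g e x)⁻¹ * LinearMap.trace ℝ _
      (fderiv ℝ (weightedComp g e X) (e x) :
        EuclideanSpace ℝ (Fin n) →ₗ[ℝ] EuclideanSpace ℝ (Fin n)) := by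
  rw [divergence_eq_chartAt g hX]
  set e' := chartAt (EuclideanSpace ℝ (Fin n)) x
  have he' : e' ∈ IsManifold.maximalAtlas (𝓡 n) ∞ M := IsManifold.chart_mem_maximalAtlas x
  have hx' : x ∈ e'.source := mem_chart_source _ x
  have hτx : (e' ∘ e.symm) (e x) = e' x := by simp [e.left_inv hx]
  have hnear : ∀ᶠ z in nhds (e x), z ∈ e.target ∧ e.symm z ∈ e'.source := by
    refine Filter.Eventually.and (e.open_target.mem_nhds (e.map_source hx)) ?_
    refine (e.continuousAt_symm (e.map_source hx)).eventually_mem ?_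
    rw [e.left_inv hx]
    exact e'.open_source.mem_nhds hx'
  -- The density of `e'` is written through `e'.symm ∘ e' ∘ e.symm`, which agrees with `e.symm` near
  -- `e x`, so that it is literally the coordinate density of `e'` composed with the transition map,
  -- as the Piola identity requires.
  have hVe' : ContDiffAt ℝ ∞ (fun y => volDens g e' ((e'.symm ∘ e' ∘ e.symm) y)) (e x) := by
    have h1 := contDiffAt_volDens g he' hx'
    rw [← hτx] at h1
    exact h1.comp (e x) (contDiffAt_transition he he' hx hx')
  have hu : ContDiffAt ℝ ∞
      (fun y => volDens g e' ((e'.symm ∘ e' ∘ e.symm) y) • chartComp e X y) (e x) :=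
    hVe'.smul (contDiffAt_chartComp he hx hX)
  have hW := contDiffAt_weightedComp g he' hx' hX
  have hP := trace_fderiv_pullback (W := weightedComp g e' X)
    ((contDiffAt_transition he he' hx hx').of_le (by norm_cast))
    (fderiv ℝ (e ∘ e'.symm) (e' x)) (fderiv_transition_comp he' he hx' hx)
    (fderiv_transition_comp he he' hx hx') (hu.differentiableAt (by simp))
    (by rw [hτx]; exact hW.differentiableAt (by simp))
    (by
      filter_upwards [hnear] with z hz
      have h1 := fderiv_transition_dchart he he' (e.map_target hz.1) hz.2 (X (e.symm z))
      rw [e.right_inv hz.1] at h1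
      rw [map_smul]
      have h2 : ∀ p q : M, p = q → dchart e' p (X p) = dchart e' q (X q) := by
        rintro p _ rfl; rfl
      unfold weightedComp chartComp
      rw [h1]
      simp only [Function.comp_apply]
      rw [h2 _ _ (e'.left_inv hz.2), e'.left_inv hz.2])
  have hcongr : weightedComp g e X =ᶠ[nhds (e x)] fun z => |(fderiv ℝ (e' ∘ e.symm) z).det| •
      (volDens g e' ((e'.symm ∘ e' ∘ e.symm) z) • chartComp e X z) := by
    filter_upwards [hnear] with z hz
    have h1 := volDens_transition g he he' (e.map_target hz.1) hz.2
    rw [e.right_inv hz.1] at h1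
    unfold weightedComp
    rw [h1, smul_smul]
    simp only [Function.comp_apply, e'.left_inv hz.2]
  rw [hcongr.fderiv_eq, hP, volDens_transition g he he' hx hx', hτx, mul_inv]
  have hdet : |(fderiv ℝ (e' ∘ e.symm) (e x)).det| ≠ 0 := by
    intro h0
    have := volDens_pos g he hx
    rw [volDens_transition g he he' hx hx', h0, zero_mul] at this
    exact lt_irrefl _ this
  field_simp

end Charts

/-! ### The Riemannian volume in charts -/

section Volume

variable {n : ℕ} {M : Type*} [TopologicalSpace M] [ChartedSpace (EuclideanSpace ℝ (Fin n)) M]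

theorem _root_.ContinuousOn.measurableSet_inter_preimage {X Y : Type*} [TopologicalSpace X]
    [MeasurableSpace X] [BorelSpace X] [TopologicalSpace Y] [MeasurableSpace Y] [BorelSpace Y]
    {f : X → Y} {s : Set X} (hf : ContinuousOn f s) (hs : MeasurableSet s) {t : Set Y}
    (ht : MeasurableSet t) : MeasurableSet (s ∩ f ⁻¹' t) := by
  have h : MeasurableSet (s.domRestrict f ⁻¹' t) :=
    (continuousOn_iff_continuous_domRestrict.1 hf).measurable ht
  have := hs.subtype_image h
  convert this using 1
  ext x
  simp [and_comm]

theorem extChartAt_target_eq (x : M) : (extChartAt (𝓡 n) x).target =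
    (chartAt (EuclideanSpace ℝ (Fin n)) x).target := by
  simp [mfld_simps]

theorem aemeasurable_chart_symm [MeasurableSpace M] [BorelSpace M] (x : M) :
    AEMeasurable (chartAt (EuclideanSpace ℝ (Fin n)) x).symm
      (volume.restrict (chartAt (EuclideanSpace ℝ (Fin n)) x).target) :=
  (chartAt (EuclideanSpace ℝ (Fin n)) x).continuousOn_symm.aemeasurable
    (chartAt (EuclideanSpace ℝ (Fin n)) x).open_target.measurableSet

variable [IsManifold (𝓡 n) ∞ M]

theorem continuousOn_volDens (g : Metric n M)
    {e : OpenPartialHomeomorph M (EuclideanSpace ℝ (Fin n))}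
    (he : e ∈ IsManifold.maximalAtlas (𝓡 n) ∞ M) :
    ContinuousOn (fun y => volDens g e (e.symm y)) e.target := by
  intro y hy
  have := (contDiffAt_volDens g he (e.map_target hy)).continuousAt
  rw [e.right_inv hy] at this
  exact this.continuousWithinAt

theorem continuousOn_density (g : Metric n M) (x : M) :
    ContinuousOn (density g x) (chartAt (EuclideanSpace ℝ (Fin n)) x).target :=
  (continuousOn_volDens g (IsManifold.chart_mem_maximalAtlas x)).congr fun _ hy => density_eq g x hy

theorem chartVolume_eq [MeasurableSpace M] (g : Metric n M) (x : M) : chartVolume g x =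
    ((volume.restrict (chartAt (EuclideanSpace ℝ (Fin n)) x).target).withDensity
    (fun y => ENNReal.ofReal (density g x y))).map (chartAt (EuclideanSpace ℝ (Fin n)) x).symm := by
  unfold chartVolume
  rw [extChartAt_target_eq]
  rfl

variable [MeasurableSpace M] [BorelSpace M]

theorem chartVolume_apply (g : Metric n M) (x : M) {A : Set M} (hA : MeasurableSet A) :
    chartVolume g x A = ∫⁻ y in (chartAt (EuclideanSpace ℝ (Fin n)) x).target ∩
      (chartAt (EuclideanSpace ℝ (Fin n)) x).symm ⁻¹' A, ENNReal.ofReal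
        (volDens g (chartAt _ x) ((chartAt (EuclideanSpace ℝ (Fin n)) x).symm y)) := by
  set e := chartAt (EuclideanSpace ℝ (Fin n)) x
  have hm := e.continuousOn_symm.measurableSet_inter_preimage e.open_target.measurableSet hA
  rw [chartVolume_eq, Measure.map_apply_of_aemeasurable
    ((aemeasurable_chart_symm x).mono_ac (withDensity_absolutelyContinuous _ _)) hA,
    withDensity_apply', Measure.restrict_restrict' e.open_target.measurableSet, Set.inter_comm]
  refine setLIntegral_congr_fun hm fun y hy => ?_
  rw [density_eq g x hy.1]

theorem chartVolume_inter_source (g : Metric n M) (x : M) {A : Set M} (hA : MeasurableSet A) :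
    chartVolume g x (A ∩ (chartAt (EuclideanSpace ℝ (Fin n)) x).source) = chartVolume g x A := by
  set e := chartAt (EuclideanSpace ℝ (Fin n)) x
  rw [chartVolume_apply g x hA, chartVolume_apply g x (hA.inter e.open_source.measurableSet)]
  congr 2
  ext y
  simp only [Set.mem_inter_iff, Set.mem_preimage]
  exact ⟨fun h => ⟨h.1, h.2.1⟩, fun h => ⟨h.1, h.2, e.map_target h.1⟩⟩

/-- Change of variables: the Jacobian of the transition map is exactly the factor by which the two
densities differ. -/
theorem chartVolume_congr (g : Metric n M) (x x' : M) {A : Set M} (hA : MeasurableSet A)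
    (h : A ⊆ (chartAt (EuclideanSpace ℝ (Fin n)) x).source)
    (h' : A ⊆ (chartAt (EuclideanSpace ℝ (Fin n)) x').source) :
    chartVolume g x A = chartVolume g x' A := by
  rw [chartVolume_apply g x hA, chartVolume_apply g x' hA]
  set e := chartAt (EuclideanSpace ℝ (Fin n)) x
  set e' := chartAt (EuclideanSpace ℝ (Fin n)) x'
  have he : e ∈ IsManifold.maximalAtlas (𝓡 n) ∞ M := IsManifold.chart_mem_maximalAtlas x
  have he' : e' ∈ IsManifold.maximalAtlas (𝓡 n) ∞ M := IsManifold.chart_mem_maximalAtlas x'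
  have himg : e'.target ∩ e'.symm ⁻¹' A = (e' ∘ e.symm) '' (e.target ∩ e.symm ⁻¹' A) := by
    ext y
    constructor
    · rintro ⟨hy, hyA⟩
      refine ⟨e (e'.symm y), ⟨e.map_source (h hyA), ?_⟩, ?_⟩
      · simpa [e.left_inv (h hyA)] using hyA
      · simp [e.left_inv (h hyA), e'.right_inv hy]
    · rintro ⟨z, ⟨hz, hzA⟩, rfl⟩
      refine ⟨e'.map_source (h' hzA), ?_⟩
      simpa [e'.left_inv (h' hzA)] using hzA
  have hd : ∀ y ∈ e.target ∩ e.symm ⁻¹' A, HasFDerivWithinAt (e' ∘ e.symm)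
      (fderiv ℝ (e' ∘ e.symm) y) (e.target ∩ e.symm ⁻¹' A) y := by
    intro y hy
    have := (contDiffAt_transition he he' (h hy.2) (h' hy.2)).differentiableAt (by simp)
    rw [e.right_inv hy.1] at this
    exact this.hasFDerivAt.hasFDerivWithinAt
  have hinj : Set.InjOn (e' ∘ e.symm) (e.target ∩ e.symm ⁻¹' A) := by
    intro y hy z hz hyz
    exact e.symm.injOn hy.1 hz.1 (e'.injOn (h' hy.2) (h' hz.2) hyz)
  have hm := e.continuousOn_symm.measurableSet_inter_preimage e.open_target.measurableSet hA
  rw [himg, lintegral_image_eq_lintegral_abs_det_fderiv_mul volume hm hd hinj]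
  refine setLIntegral_congr_fun hm fun y hy => ?_
  have := volDens_transition g he he' (h hy.2) (h' hy.2)
  rw [e.right_inv hy.1] at this
  simp only [Function.comp_apply]
  rw [this, e'.left_inv (h' hy.2), ENNReal.ofReal_mul (abs_nonneg _)]

variable [SecondCountableTopology M]

/-- Chart measures agree on overlaps. Gluing countably many of them along a disjoint cover gives a
measure `ν` that dominates every chart measure, hence their supremum, and that equals the chart
measure inside a single chart. -/
theorem riemVolume_eq_chartVolume (g : Metric n M) (x : M) {A : Set M} (hA : MeasurableSet A)
    (h : A ⊆ (chartAt (EuclideanSpace ℝ (Fin n)) x).source) :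
    riemVolume g A = chartVolume g x A := by
  refine le_antisymm ?_ (le_iSup (chartVolume g) x A)
  obtain ⟨s, hs, hsU⟩ := TopologicalSpace.countable_cover_nhds
    fun x : M => chart_source_mem_nhds (EuclideanSpace ℝ (Fin n)) x
  have hne : s.Nonempty := by
    by_contra hne
    rw [Set.not_nonempty_iff_eq_empty] at hne
    subst hne
    simp only [Set.mem_empty_iff_false, Set.iUnion_of_empty, Set.iUnion_empty] at hsU
    exact absurd (Set.mem_univ x) (by simp [← hsU])
  obtain ⟨f, rfl⟩ := hs.exists_eq_range hne
  let U : ℕ → Set M := fun k => (chartAt (EuclideanSpace ℝ (Fin n)) (f k)).source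
  have hUm : ∀ k, MeasurableSet (disjointed U k) :=
    MeasurableSet.disjointed fun k =>
      (chartAt (EuclideanSpace ℝ (Fin n)) (f k)).open_source.measurableSet
  have hUu : ⋃ k, disjointed U k = Set.univ := by
    rw [iUnion_disjointed, ← hsU]
    simp [U]
  let ν : Measure M := Measure.sum fun k => (chartVolume g (f k)).restrict (disjointed U k)
  have hsplit : ∀ z : M, ∀ B : Set M, MeasurableSet B →
      chartVolume g z B = ∑' k, chartVolume g (f k)
        (B ∩ disjointed U k ∩ (chartAt (EuclideanSpace ℝ (Fin n)) z).source) := by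
    intro z B hB
    have h1 : B = ⋃ k, B ∩ disjointed U k := by rw [← Set.inter_iUnion, hUu, Set.inter_univ]
    conv_lhs => rw [h1]
    rw [measure_iUnion (fun i j hij => (disjoint_disjointed U hij).mono Set.inter_subset_right
      Set.inter_subset_right) fun k => hB.inter (hUm k)]
    refine tsum_congr fun k => ?_
    rw [← chartVolume_inter_source g z (hB.inter (hUm k))]
    exact chartVolume_congr g _ _ ((hB.inter (hUm k)).inter
      (chartAt (EuclideanSpace ℝ (Fin n)) z).open_source.measurableSet) Set.inter_subset_right
      (Set.inter_subset_left.trans (Set.inter_subset_right.trans (disjointed_subset U k)))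
  have hν : ∀ B : Set M, MeasurableSet B →
      ν B = ∑' k, chartVolume g (f k) (B ∩ disjointed U k) := by
    intro B hB
    rw [Measure.sum_apply _ hB]
    exact tsum_congr fun k => Measure.restrict_apply hB
  have hle : riemVolume g ≤ ν := by
    refine iSup_le fun z => Measure.le_iff.2 fun B hB => ?_
    rw [hsplit z B hB, hν B hB]
    exact ENNReal.tsum_le_tsum fun k => measure_mono Set.inter_subset_left
  refine (hle A).trans (le_of_eq ?_)
  rw [hν A hA, hsplit x A hA]
  refine tsum_congr fun k => ?_
  congr 1
  exact (Set.inter_eq_left.2 (Set.inter_subset_left.trans h)).symm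

theorem riemVolume_restrict_source (g : Metric n M) (x : M) :
    (riemVolume g).restrict (chartAt (EuclideanSpace ℝ (Fin n)) x).source = chartVolume g x := by
  ext A hA
  have hS := (chartAt (EuclideanSpace ℝ (Fin n)) x).open_source.measurableSet
  rw [Measure.restrict_apply hA, riemVolume_eq_chartVolume g x (hA.inter hS) Set.inter_subset_right,
    chartVolume_inter_source g x hA]

/-- The density is continuous, hence integrable over a small closed coordinate ball. This is what
makes compactly supported continuous functions integrable. -/
instance isLocallyFiniteMeasure_riemVolume (g : Metric n M) :
    IsLocallyFiniteMeasure (riemVolume g) := by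
  refine ⟨fun x => ?_⟩
  set e := chartAt (EuclideanSpace ℝ (Fin n)) x with he_def
  have he : e ∈ IsManifold.maximalAtlas (𝓡 n) ∞ M := IsManifold.chart_mem_maximalAtlas x
  have hx : x ∈ e.source := mem_chart_source _ x
  obtain ⟨r, hr, hrt⟩ := Metric.nhds_basis_closedBall.mem_iff.1
    (e.open_target.mem_nhds (e.map_source hx))
  let N : Set M := e.source ∩ e ⁻¹' Metric.ball (e x) r
  have hNo : IsOpen N := e.isOpen_inter_preimage Metric.isOpen_ball
  refine ⟨N, hNo.mem_nhds ⟨hx, Metric.mem_ball_self hr⟩, ?_⟩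
  rw [riemVolume_eq_chartVolume g x hNo.measurableSet Set.inter_subset_left,
    chartVolume_apply g x hNo.measurableSet]
  have hint : IntegrableOn (fun y => volDens g e (e.symm y)) (Metric.closedBall (e x) r) :=
    ((continuousOn_volDens g he).mono hrt).integrableOn_compact (isCompact_closedBall _ _)
  refine lt_of_le_of_lt ?_ (Integrable.lintegral_lt_top hint)
  refine lintegral_mono_set fun y hy => ?_
  have := hy.2.2
  rw [Set.mem_preimage, e.right_inv hy.1] at this
  exact Metric.ball_subset_closedBall this

theorem integral_eq_integral_chart (g : Metric n M) (x : M) {f : M → ℝ} (hf : Continuous f)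
    (h : ∀ z, z ∉ (chartAt (EuclideanSpace ℝ (Fin n)) x).source → f z = 0) :
    ∫ z, f z ∂(riemVolume g) = ∫ y in (chartAt (EuclideanSpace ℝ (Fin n)) x).target,
      volDens g (chartAt _ x) ((chartAt (EuclideanSpace ℝ (Fin n)) x).symm y) *
        f ((chartAt (EuclideanSpace ℝ (Fin n)) x).symm y) := by
  set e := chartAt (EuclideanSpace ℝ (Fin n)) x
  have hm : AEMeasurable (fun y => ENNReal.ofReal (density g x y)) (volume.restrict e.target) :=
    ((continuousOn_density g x).aemeasurable e.open_target.measurableSet).ennreal_ofReal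
  rw [← setIntegral_eq_integral_of_forall_compl_eq_zero h, riemVolume_restrict_source,
    chartVolume_eq, integral_map ((aemeasurable_chart_symm x).mono_ac
      (withDensity_absolutelyContinuous _ _)) hf.aestronglyMeasurable,
    integral_withDensity_eq_integral_toReal_smul₀ hm (by simp)]
  refine setIntegral_congr_fun e.open_target.measurableSet fun y hy => ?_
  rw [density_eq g x hy, ENNReal.toReal_ofReal (show 0 ≤ volDens g _ _ from Real.sqrt_nonneg _)]
  rfl

end Volume

/-! ### The divergence theorem -/

theorem integral_fderiv_apply_eq_zero {E : Type*} [NormedAddCommGroup E] [NormedSpace ℝ E]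
    [FiniteDimensional ℝ E] [MeasurableSpace E] [BorelSpace E] (μ : Measure E) [μ.IsAddHaarMeasure]
    {h : E → ℝ} (hh : ContDiff ℝ 1 h) (hc : HasCompactSupport h) (v : E) :
    ∫ y, fderiv ℝ h y v ∂μ = 0 := by
  have hcont : Continuous fun y => fderiv ℝ h y v :=
    (hh.continuous_fderiv (by norm_num)).clm_apply continuous_const
  have hcs : HasCompactSupport fun y => fderiv ℝ h y v := hc.fderiv_apply (𝕜 := ℝ) v
  have := integral_mul_fderiv_eq_neg_fderiv_mul_of_integrable (μ := μ) (f := fun _ : E => (1 : ℝ))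
    (g := h) (v := v) (by simp) (by simpa using hcont.integrable_of_hasCompactSupport hcs)
    (by simpa using hh.continuous.integrable_of_hasCompactSupport hc)
    (fun _ _ => differentiableAt_const _) (fun _ _ => hh.differentiable (by norm_num) _)
  simpa using this

theorem integral_trace_fderiv_eq_zero {n : ℕ}
    {G : EuclideanSpace ℝ (Fin n) → EuclideanSpace ℝ (Fin n)} (hG : ContDiff ℝ 1 G)
    (hc : HasCompactSupport G) :
    ∫ y, LinearMap.trace ℝ _ (fderiv ℝ G y : EuclideanSpace ℝ (Fin n) →ₗ[ℝ] _) = 0 := by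
  have hi : ∀ i : Fin n, ContDiff ℝ 1 fun y => G y i := fun i =>
    (EuclideanSpace.proj (𝕜 := ℝ) i).contDiff.comp hG
  have hci : ∀ i : Fin n, HasCompactSupport fun y => G y i := fun i =>
    hc.comp_left (g := fun v : EuclideanSpace ℝ (Fin n) => v i) rfl
  have hd : ∀ y, ∀ i, fderiv ℝ (fun y => G y i) y (EuclideanSpace.single i 1) =
      fderiv ℝ G y (EuclideanSpace.single i 1) i := by
    intro y i
    have := (EuclideanSpace.proj (𝕜 := ℝ) i).hasFDerivAt.comp y
      (hG.differentiable (by norm_num) y).hasFDerivAt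
    exact congrArg (fun L : EuclideanSpace ℝ (Fin n) →L[ℝ] ℝ => L (EuclideanSpace.single i 1))
      this.fderiv
  simp_rw [trace_eq_sum_single, ← hd]
  rw [integral_finsetSum _ fun i _ => ?_]
  · exact Finset.sum_eq_zero fun i _ => integral_fderiv_apply_eq_zero volume (hi i) (hci i) _
  · exact (((hi i).continuous_fderiv (by norm_num)).clm_apply
      continuous_const).integrable_of_hasCompactSupport ((hci i).fderiv_apply (𝕜 := ℝ) _)

section DivergenceTheorem

variable {n : ℕ} {M : Type*} [TopologicalSpace M] [ChartedSpace (EuclideanSpace ℝ (Fin n)) M]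

/-- The derivative of a function along a vector field. -/
def dirDeriv (u : M → ℝ) (X : VField n M) (x : M) : ℝ :=
  mfderiv (𝓡 n) 𝓘(ℝ, ℝ) u x (X x)

theorem dirDeriv_sum {ι : Type*} (X : VField n M) {x : M} (I : Finset ι) {w : ι → M → ℝ}
    (hw : ∀ i ∈ I, MDifferentiableAt (𝓡 n) 𝓘(ℝ, ℝ) (w i) x) :
    dirDeriv (fun x => ∑ i ∈ I, w i x) X x = ∑ i ∈ I, dirDeriv (w i) X x := by
  classical
  suffices h : ∃ L : TangentSpace (𝓡 n) x →L[ℝ] ℝ,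
      HasMFDerivAt (𝓡 n) 𝓘(ℝ, ℝ) (fun x => ∑ i ∈ I, w i x) x L ∧
      L (X x) = ∑ i ∈ I, dirDeriv (w i) X x by
    obtain ⟨L, hL, hLX⟩ := h
    unfold dirDeriv at *
    rw [hL.mfderiv]
    exact hLX
  induction I using Finset.induction_on with
  | empty =>
    refine ⟨0, ?_, rfl⟩
    simp only [Finset.sum_empty]
    exact hasMFDerivAt_const (0 : ℝ) x
  | insert a s ha ih =>
    obtain ⟨L, hL, hLX⟩ := ih fun i hi => hw i (Finset.mem_insert_of_mem hi)
    have h : (fun x => ∑ i ∈ insert a s, w i x) = w a + fun x => ∑ i ∈ s, w i x := by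
      funext z
      simp [Finset.sum_insert ha]
    rw [h, Finset.sum_insert ha]
    refine ⟨_, (hw a (Finset.mem_insert_self a s)).hasMFDerivAt.add hL, ?_⟩
    rw [← hLX]
    rfl

theorem mfderiv_apply_eq_chart {e : OpenPartialHomeomorph M (EuclideanSpace ℝ (Fin n))}
    (he : e ∈ IsManifold.maximalAtlas (𝓡 n) ∞ M) {x : M} (hx : x ∈ e.source) {u : M → ℝ}
    (hu : ContMDiffAt (𝓡 n) 𝓘(ℝ, ℝ) 1 u x) (v : TangentSpace (𝓡 n) x) :
    mfderiv (𝓡 n) 𝓘(ℝ, ℝ) u x v = fderiv ℝ (u ∘ e.symm) (e x) (dchart e x v) := by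
  have h1 : HasMFDerivAt (𝓡 n) (𝓡 n) e x (dchart e x) :=
    ((mdifferentiable_of_mem he).mdifferentiableAt hx).hasMFDerivAt
  have h0 : ContMDiffAt (𝓡 n) 𝓘(ℝ, ℝ) 1 (u ∘ e.symm) (e x) := by
    refine ContMDiffAt.comp (I' := 𝓡 n) _ (by rwa [e.left_inv hx])
      ((contMDiffAt_symm_of_mem_maximalAtlas he (e.map_source hx)).of_le (by norm_cast))
  have h2 : HasMFDerivAt (𝓡 n) 𝓘(ℝ, ℝ) (u ∘ e.symm) (e x) (fderiv ℝ (u ∘ e.symm) (e x)) :=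
    ((contMDiffAt_iff_contDiffAt.1 h0).differentiableAt (by norm_num)).hasFDerivAt.hasMFDerivAt
  have h3 := h2.comp x h1
  have h5 : u =ᶠ[nhds x] (u ∘ e.symm) ∘ e := by
    filter_upwards [e.open_source.mem_nhds hx] with z hz
    simp [e.left_inv hz]
  have h6 := (h3.congr_of_eventuallyEq h5).mfderiv
  exact congrArg (fun L : EuclideanSpace ℝ (Fin n) →L[ℝ] ℝ => L v) h6

theorem contDiffAt_comp_chart_symm {e : OpenPartialHomeomorph M (EuclideanSpace ℝ (Fin n))}
    (he : e ∈ IsManifold.maximalAtlas (𝓡 n) ∞ M) {x : M} (hx : x ∈ e.source) {u : M → ℝ}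
    (hu : ContMDiffAt (𝓡 n) 𝓘(ℝ, ℝ) 1 u x) : ContDiffAt ℝ 1 (u ∘ e.symm) (e x) := by
  rw [← contMDiffAt_iff_contDiffAt]
  exact ContMDiffAt.comp (I' := 𝓡 n) _ (by rwa [e.left_inv hx])
    ((contMDiffAt_symm_of_mem_maximalAtlas he (e.map_source hx)).of_le (by norm_cast))

variable [IsManifold (𝓡 n) ∞ M]

theorem continuousAt_dirDeriv {X : VField n M} {x : M}
    (hX : ContMDiffAt (𝓡 n) (𝓡 n).tangent ∞ (fun x => (⟨x, X x⟩ : TangentBundle (𝓡 n) M)) x)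
    {u : M → ℝ} (hu : ContMDiff (𝓡 n) 𝓘(ℝ, ℝ) 1 u) :
    ContinuousAt (dirDeriv u X) x := by
  set e := chartAt (EuclideanSpace ℝ (Fin n)) x
  have he : e ∈ IsManifold.maximalAtlas (𝓡 n) ∞ M := IsManifold.chart_mem_maximalAtlas x
  have hx : x ∈ e.source := mem_chart_source _ x
  have h1 : ContinuousAt (fun y => fderiv ℝ (u ∘ e.symm) y (chartComp e X y)) (e x) :=
    ((contDiffAt_comp_chart_symm he hx (hu x)).fderiv_right (m := 0)
      (by norm_num)).continuousAt.clm_apply (contDiffAt_chartComp he hx hX).continuousAt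
  refine (h1.comp (e.continuousAt hx)).congr ?_
  filter_upwards [e.open_source.mem_nhds hx] with z hz
  have h2 : ∀ p q : M, p = q → dchart e p (X p) = dchart e q (X q) := by
    rintro p _ rfl; rfl
  unfold dirDeriv
  rw [mfderiv_apply_eq_chart he hz (hu z)]
  simp only [Function.comp_apply, chartComp]
  rw [h2 _ _ (e.left_inv hz)]

/-- The definition changes chart with the point; continuity becomes visible only after
`divergence_eq` fixes one chart. -/
theorem continuousAt_divergence (g : Metric n M) {X : VField n M} {x : M}
    (hX : ∀ᶠ z in nhds x, ContMDiffAt (𝓡 n) (𝓡 n).tangent ∞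
      (fun x => (⟨x, X x⟩ : TangentBundle (𝓡 n) M)) z) :
    ContinuousAt (divergence g X) x := by
  set e := chartAt (EuclideanSpace ℝ (Fin n)) x
  have he : e ∈ IsManifold.maximalAtlas (𝓡 n) ∞ M := IsManifold.chart_mem_maximalAtlas x
  have hx : x ∈ e.source := mem_chart_source _ x
  have h1 : ContinuousAt (fun y => (volDens g e (e.symm y))⁻¹ * LinearMap.trace ℝ _
      (fderiv ℝ (weightedComp g e X) y :
        EuclideanSpace ℝ (Fin n) →ₗ[ℝ] EuclideanSpace ℝ (Fin n))) (e x) := by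
    refine ContinuousAt.mul ((contDiffAt_volDens g he hx).continuousAt.inv₀ ?_) ?_
    · rw [e.left_inv hx]
      exact (volDens_pos g he hx).ne'
    · have h2 := ((contDiffAt_weightedComp g he hx hX.self_of_nhds).fderiv_right (m := 0)
        (by norm_num)).continuousAt
      simp_rw [trace_eq_sum_single]
      refine tendsto_finsetSum _ fun i _ => ?_
      exact (EuclideanSpace.proj (𝕜 := ℝ) i).continuous.continuousAt.comp
        (h2.clm_apply continuousAt_const)
  refine (h1.comp (e.continuousAt hx)).congr ?_
  filter_upwards [e.open_source.mem_nhds hx, hX] with z hz hXz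
  rw [divergence_eq g he hz hXz]
  simp only [Function.comp_apply, e.left_inv hz]

/-- The divergence of `u X`. -/
def divSMul (g : Metric n M) (X : VField n M) (u : M → ℝ) (x : M) : ℝ :=
  u x * divergence g X x + dirDeriv u X x

theorem divSMul_eq_zero (g : Metric n M) (X : VField n M) {u : M → ℝ} {x : M}
    (hx : x ∉ tsupport u) : divSMul g X u x = 0 := by
  have h0 : u =ᶠ[nhds x] fun _ => 0 := notMem_tsupport_iff_eventuallyEq.1 hx
  unfold divSMul dirDeriv
  rw [h0.mfderiv_eq, mfderiv_const, h0.eq_of_nhds, zero_mul]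
  exact add_zero (0 : ℝ)

theorem hasCompactSupport_divSMul (g : Metric n M) (X : VField n M) {u : M → ℝ}
    (hc : HasCompactSupport u) : HasCompactSupport (divSMul g X u) := by
  refine hc.mono' fun x hx => ?_
  by_contra h
  exact hx (divSMul_eq_zero g X h)

theorem continuous_divSMul (g : Metric n M) {X : VField n M} {u : M → ℝ} {Ω : Set M}
    (hΩ : IsOpen Ω) (hX : ∀ x ∈ Ω, ContMDiffAt (𝓡 n) (𝓡 n).tangent ∞
      (fun x => (⟨x, X x⟩ : TangentBundle (𝓡 n) M)) x)
    (hu : ContMDiff (𝓡 n) 𝓘(ℝ, ℝ) 1 u) (hs : tsupport u ⊆ Ω) : Continuous (divSMul g X u) := by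
  rw [continuous_iff_continuousAt]
  intro x
  by_cases hx : x ∈ tsupport u
  · refine ContinuousAt.add (ContinuousAt.mul hu.continuous.continuousAt
      (continuousAt_divergence g ?_)) (continuousAt_dirDeriv (hX x (hs hx)) hu)
    filter_upwards [hΩ.mem_nhds (hs hx)] with z hz using hX z hz
  · have : divSMul g X u =ᶠ[nhds x] fun _ => 0 := by
      filter_upwards [(isClosed_tsupport u).isOpen_compl.mem_nhds hx] with z hz
      exact divSMul_eq_zero g X hz
    exact continuousAt_const.congr this.symm

/-- The product rule in a chart. It is proved for `divSMul` directly because `u` is only C¹, while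
`divergence_eq` asks for a smooth field. -/
theorem volDens_mul_divSMul (g : Metric n M)
    {e : OpenPartialHomeomorph M (EuclideanSpace ℝ (Fin n))}
    (he : e ∈ IsManifold.maximalAtlas (𝓡 n) ∞ M) {x : M} (hx : x ∈ e.source) {X : VField n M}
    (hX : ContMDiffAt (𝓡 n) (𝓡 n).tangent ∞ (fun x => (⟨x, X x⟩ : TangentBundle (𝓡 n) M)) x)
    {u : M → ℝ} (hu : ContMDiffAt (𝓡 n) 𝓘(ℝ, ℝ) 1 u x) :
    volDens g e x * divSMul g X u x = LinearMap.trace ℝ _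
      (fderiv ℝ (fun y => u (e.symm y) • weightedComp g e X y) (e x) :
        EuclideanSpace ℝ (Fin n) →ₗ[ℝ] EuclideanSpace ℝ (Fin n)) := by
  have h1 := (contDiffAt_comp_chart_symm he hx hu).differentiableAt (by norm_num)
  have h2 := (contDiffAt_weightedComp g he hx hX).differentiableAt (by simp)
  have h3 := (h1.hasFDerivAt.smul h2.hasFDerivAt).fderiv
  change fderiv ℝ (fun y => u (e.symm y) • weightedComp g e X y) (e x) = _ at h3
  have htr : ∀ L : EuclideanSpace ℝ (Fin n) →L[ℝ] ℝ, ∀ w : EuclideanSpace ℝ (Fin n),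
      LinearMap.trace ℝ _ (L.smulRight w : EuclideanSpace ℝ (Fin n) →ₗ[ℝ] _) = L w :=
    fun L w => LinearMap.trace_smulRight _ _
  have h4 : ∀ p q : M, p = q → dchart e p (X p) = dchart e q (X q) := by
    rintro p _ rfl; rfl
  rw [h3, ContinuousLinearMap.toLinearMap_add, map_add, ContinuousLinearMap.toLinearMap_smul,
    map_smul, htr]
  unfold divSMul dirDeriv
  rw [divergence_eq g he hx hX, mfderiv_apply_eq_chart he hx hu]
  have h5 : weightedComp g e X (e x) = volDens g e x • dchart e x (X x) := by
    unfold weightedComp chartComp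
    rw [h4 _ _ (e.left_inv hx), e.left_inv hx]
  rw [h5, map_smul]
  have := (volDens_pos g he hx).ne'
  simp only [Function.comp_apply, e.left_inv hx, smul_eq_mul]
  field_simp

variable [MeasurableSpace M] [BorelSpace M] [SecondCountableTopology M]

theorem integral_divSMul_eq_zero_of_chart (g : Metric n M) {X : VField n M} {u : M → ℝ} {Ω : Set M}
    (hΩ : IsOpen Ω) (hX : ∀ x ∈ Ω, ContMDiffAt (𝓡 n) (𝓡 n).tangent ∞
      (fun x => (⟨x, X x⟩ : TangentBundle (𝓡 n) M)) x)
    (hu : ContMDiff (𝓡 n) 𝓘(ℝ, ℝ) 1 u) (hc : HasCompactSupport u) (hs : tsupport u ⊆ Ω) (x : M)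
    (hx : tsupport u ⊆ (chartAt (EuclideanSpace ℝ (Fin n)) x).source) :
    ∫ z, divSMul g X u z ∂(riemVolume g) = 0 := by
  rw [integral_eq_integral_chart g x (continuous_divSMul g hΩ hX hu hs)
    fun z hz => divSMul_eq_zero g X fun h => hz (hx h)]
  set e := chartAt (EuclideanSpace ℝ (Fin n)) x
  have he : e ∈ IsManifold.maximalAtlas (𝓡 n) ∞ M := IsManifold.chart_mem_maximalAtlas x
  let G₀ := fun y => u (e.symm y) • weightedComp g e X y
  -- Extension by zero from the chart image: since `G` vanishes off the compact set `e '' tsupport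
  -- u`, it is C¹ on the whole Euclidean space.
  let G := e.target.indicator G₀
  have hGG₀ : ∀ y ∈ e.target, G =ᶠ[nhds y] G₀ := by
    intro y hy
    filter_upwards [e.open_target.mem_nhds hy] with z hz
    exact Set.indicator_of_mem hz _
  have hK : IsCompact (e '' tsupport u) := hc.isCompact.image_of_continuousOn (e.continuousOn.mono hx)
  have hG0 : ∀ y, y ∉ e '' tsupport u → G =ᶠ[nhds y] fun _ => 0 := by
    intro y hy
    filter_upwards [hK.isClosed.isOpen_compl.mem_nhds hy] with z hz
    by_cases hzt : z ∈ e.target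
    · have h1 : e.symm z ∉ tsupport u := fun h => hz ⟨_, h, e.right_inv hzt⟩
      simp only [G, Set.indicator_of_mem hzt, G₀]
      rw [image_eq_zero_of_notMem_tsupport h1, zero_smul]
    · exact Set.indicator_of_notMem hzt _
  have hGcd : ContDiff ℝ 1 G := by
    rw [contDiff_iff_contDiffAt]
    intro y
    by_cases hy : y ∈ e '' tsupport u
    · obtain ⟨z, hz, rfl⟩ := hy
      refine ContDiffAt.congr_of_eventuallyEq ?_ (hGG₀ _ (e.map_source (hx hz)))
      have h1 := contDiffAt_comp_chart_symm he (hx hz) (hu z)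
      have h2 : ContDiffAt ℝ 1 (weightedComp g e X) (e z) :=
        (contDiffAt_weightedComp g he (hx hz) (hX z (hs hz))).of_le (by norm_cast)
      exact h1.smul h2
    · exact contDiffAt_const.congr_of_eventuallyEq (hG0 y hy)
  have hGc : HasCompactSupport G := by
    refine HasCompactSupport.intro hK fun y hy => (hG0 y hy).eq_of_nhds
  refine Eq.trans ?_ ((setIntegral_eq_integral_of_forall_compl_eq_zero (s := e.target) ?_).trans
    (integral_trace_fderiv_eq_zero hGcd hGc))
  · refine setIntegral_congr_fun e.open_target.measurableSet fun y hy => ?_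
    by_cases h : e.symm y ∈ tsupport u
    · have := volDens_mul_divSMul g he (hx h) (hX _ (hs h)) (hu _)
      rw [e.right_inv hy] at this
      beta_reduce
      rw [this, (hGG₀ y hy).fderiv_eq]
    · have h1 : y ∉ e '' tsupport u := by
        rintro ⟨z, hz, rfl⟩
        exact h (by rwa [e.left_inv (hx hz)])
      beta_reduce
      rw [divSMul_eq_zero g X h, (hG0 y h1).fderiv_eq]
      simp
  · intro y hy
    have h1 : y ∉ e '' tsupport u := by
      rintro ⟨z, hz, rfl⟩
      exact hy (e.map_source (hx hz))
    rw [(hG0 y h1).fderiv_eq]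
    simp

variable [T2Space M]

/-- The divergence theorem for `u X` with `u` of class `C¹` and compactly supported. -/
theorem integral_divSMul_eq_zero (g : Metric n M) {X : VField n M} {u : M → ℝ} {Ω : Set M}
    (hΩ : IsOpen Ω) (hX : ∀ x ∈ Ω, ContMDiffAt (𝓡 n) (𝓡 n).tangent ∞
      (fun x => (⟨x, X x⟩ : TangentBundle (𝓡 n) M)) x)
    (hu : ContMDiff (𝓡 n) 𝓘(ℝ, ℝ) 1 u) (hc : HasCompactSupport u) (hs : tsupport u ⊆ Ω) :
    ∫ z, divSMul g X u z ∂(riemVolume g) = 0 := by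
  have : LocallyCompactSpace M := ChartedSpace.locallyCompactSpace (EuclideanSpace ℝ (Fin n)) M
  obtain ⟨ρ, hρ⟩ := SmoothPartitionOfUnity.exists_isSubordinate (𝓡 n) (isClosed_univ (X := M))
    (fun x : M => (chartAt (EuclideanSpace ℝ (Fin n)) x).source)
    (fun x => (chartAt (EuclideanSpace ℝ (Fin n)) x).open_source)
    (fun x _ => Set.mem_iUnion.2 ⟨x, mem_chart_source _ x⟩)
  -- By local finiteness only finitely many members of the partition of unity meet the compact
  -- support of `u`, so the decomposition of `u` is a finite sum.
  have hfin : {i | ((tsupport fun x => ρ i x) ∩ tsupport u).Nonempty}.Finite :=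
    ρ.locallyFinite.closure.finite_nonempty_inter_compact hc.isCompact
  set I := hfin.toFinset
  let w : M → M → ℝ := fun i x => ρ i x * u x
  have hw1 : ∀ i, ContMDiff (𝓡 n) 𝓘(ℝ, ℝ) 1 (w i) := fun i =>
    ((ρ i).contMDiff.of_le (by norm_cast)).mul hu
  have hwu : ∀ i, tsupport (w i) ⊆ tsupport u := fun i => tsupport_mul_subset_right
  have hwρ : ∀ i, tsupport (w i) ⊆ tsupport (ρ i) := fun i => tsupport_mul_subset_left
  have hwc : ∀ i, HasCompactSupport (w i) := fun i => hc.mul_left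
  have hsum : ∀ x, u x = ∑ i ∈ I, w i x := by
    intro x
    by_cases hx : x ∈ tsupport u
    · have h1 : ∑ i ∈ I, ρ i x = 1 := by
        refine ρ.sum_finsupport' x (Set.mem_univ x) fun i hi => ?_
        rw [Set.Finite.mem_toFinset]
        exact ⟨x, subset_tsupport _ ((ρ.mem_finsupport x).1 hi), hx⟩
      simp only [w, ← Finset.sum_mul, h1, one_mul]
    · simp [w, image_eq_zero_of_notMem_tsupport hx]
  have hdiv : ∀ x, divSMul g X u x = ∑ i ∈ I, divSMul g X (w i) x := by
    intro x
    have h2 : u = fun x => ∑ i ∈ I, w i x := funext hsum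
    have h3 : dirDeriv u X x = ∑ i ∈ I, dirDeriv (w i) X x := by
      rw [h2]
      exact dirDeriv_sum X I fun i _ => (hw1 i).mdifferentiable (by norm_num) x
    unfold divSMul
    rw [h3, Finset.sum_add_distrib, ← Finset.sum_mul, ← hsum x]
  simp_rw [hdiv]
  rw [integral_finsetSum]
  · exact Finset.sum_eq_zero fun i _ => integral_divSMul_eq_zero_of_chart g hΩ hX (hw1 i) (hwc i)
      ((hwu i).trans hs) i ((hwρ i).trans (hρ i))
  · exact fun i _ => (continuous_divSMul g hΩ hX (hw1 i)
      ((hwu i).trans hs)).integrable_of_hasCompactSupport (hasCompactSupport_divSMul g X (hwc i))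

end DivergenceTheorem

/-! ### Integral inequalities for the passage to the limit -/

theorem ofReal_integral_le_lintegral_ofReal {α : Type*} [MeasurableSpace α] {μ : Measure α}
    {w : α → ℝ} (hw : Integrable w μ) :
    ENNReal.ofReal (∫ x, w x ∂μ) ≤ ∫⁻ x, ENNReal.ofReal (w x) ∂μ := by
  calc ENNReal.ofReal (∫ x, w x ∂μ) ≤ ENNReal.ofReal (∫ x, max (w x) 0 ∂μ) :=
        ENNReal.ofReal_le_ofReal (integral_mono hw hw.pos_part fun x => le_max_left _ _)
    _ = ∫⁻ x, ENNReal.ofReal (max (w x) 0) ∂μ :=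
        ofReal_integral_eq_lintegral_ofReal hw.pos_part (.of_forall fun x => le_max_right _ _)
    _ = ∫⁻ x, ENNReal.ofReal (w x) ∂μ := by simp [ENNReal.ofReal_max]

/-- The quasi-triangle inequality for `∫ F ^ p`, with constants from the convexity of `x ↦ x ^ p`.
Only one of the two functions has to be measurable. -/
theorem lintegral_rpow_le_of_le_add {α : Type*} [MeasurableSpace α] {μ : Measure α} {p : ℝ}
    (hp : 1 ≤ p) {t : ℝ} (ht0 : 0 < t) (ht1 : t < 1) {F G H : α → ℝ≥0∞} (hF : AEMeasurable F μ)
    (h : ∀ x, H x ≤ F x + G x) :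
    ∫⁻ x, H x ^ p ∂μ ≤ ENNReal.ofReal ((1 - t) ^ (1 - p)) * ∫⁻ x, F x ^ p ∂μ +
      ENNReal.ofReal (t ^ (1 - p)) * ∫⁻ x, G x ^ p ∂μ := by
  have key : ∀ s : ℝ, 0 < s → ∀ z : ℝ≥0∞, ENNReal.ofReal s * (ENNReal.ofReal s⁻¹ * z) ^ p =
      ENNReal.ofReal (s ^ (1 - p)) * z ^ p := by
    intro s hs z
    rw [ENNReal.mul_rpow_of_nonneg _ _ (by linarith), ← mul_assoc,
      ENNReal.ofReal_rpow_of_pos (inv_pos.2 hs), ← ENNReal.ofReal_mul hs.le,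
      Real.inv_rpow hs.le, Real.rpow_sub hs, Real.rpow_one, div_eq_mul_inv]
  have hs : ∀ s : ℝ, 0 < s → ∀ z : ℝ≥0∞, ENNReal.ofReal s * (ENNReal.ofReal s⁻¹ * z) = z := by
    intro s hs z
    rw [← mul_assoc, ← ENNReal.ofReal_mul hs.le, mul_inv_cancel₀ hs.ne', ENNReal.ofReal_one,
      one_mul]
  have ht : 0 < 1 - t := by linarith
  have hpt : ∀ x, H x ^ p ≤ ENNReal.ofReal ((1 - t) ^ (1 - p)) * F x ^ p +
      ENNReal.ofReal (t ^ (1 - p)) * G x ^ p := by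
    intro x
    have h1 := ENNReal.rpow_arith_mean_le_arith_mean2_rpow (ENNReal.ofReal (1 - t))
      (ENNReal.ofReal t) (ENNReal.ofReal (1 - t)⁻¹ * F x) (ENNReal.ofReal t⁻¹ * G x)
      (by rw [← ENNReal.ofReal_add ht.le ht0.le]; simp) hp
    rw [hs _ ht, hs _ ht0, key _ ht, key _ ht0] at h1
    exact (ENNReal.rpow_le_rpow (h x) (by linarith)).trans h1
  refine (lintegral_mono hpt).trans ?_
  rw [lintegral_add_left' ((hF.pow_const p).const_mul _), lintegral_const_mul' _ _ (by simp),
    lintegral_const_mul' _ _ (by simp)]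

/-! ### The pointwise norm of the metric -/

section Norm

variable {n : ℕ} {M : Type*} [TopologicalSpace M] [ChartedSpace (EuclideanSpace ℝ (Fin n)) M]
  [IsManifold (𝓡 n) ∞ M] (g : Metric n M) {x : M}

theorem inner_self_nonneg (v : TangentSpace (𝓡 n) x) : 0 ≤ g.inner x v v := by
  rcases eq_or_ne v 0 with rfl | hv
  · simp
  · exact (g.pos x v hv).le

theorem vnorm_nonneg (v : TangentSpace (𝓡 n) x) : 0 ≤ vnorm g v := Real.sqrt_nonneg _

theorem vnorm_sq (v : TangentSpace (𝓡 n) x) : vnorm g v ^ 2 = g.inner x v v :=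
  Real.sq_sqrt (inner_self_nonneg g v)

theorem abs_inner_le (v w : TangentSpace (𝓡 n) x) : |g.inner x v w| ≤ vnorm g v * vnorm g w := by
  have h : ∀ t : ℝ, 0 ≤ g.inner x w w * (t * t) + (2 * g.inner x v w) * t + g.inner x v v := by
    intro t
    have := inner_self_nonneg g (v + t • w)
    simp only [map_add, map_smul, add_apply, smul_apply, smul_eq_mul] at this
    rw [g.symm x w v] at this
    linarith
  have h2 := discrim_le_zero h
  unfold discrim at h2
  refine abs_le_of_sq_le_sq ?_ (mul_nonneg (vnorm_nonneg g v) (vnorm_nonneg g w))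
  rw [mul_pow, vnorm_sq, vnorm_sq]
  linarith

theorem vnorm_add_le (v w : TangentSpace (𝓡 n) x) : vnorm g (v + w) ≤ vnorm g v + vnorm g w := by
  refine abs_le_of_sq_le_sq' ?_ (add_nonneg (vnorm_nonneg g v) (vnorm_nonneg g w)) |>.2
  rw [vnorm_sq, add_sq, vnorm_sq, vnorm_sq]
  simp only [map_add, add_apply]
  rw [g.symm x w v]
  linarith [(abs_le.1 (abs_inner_le g v w)).2]

theorem vnorm_smul (c : ℝ) (v : TangentSpace (𝓡 n) x) : vnorm g (c • v) = |c| * vnorm g v := by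
  unfold vnorm
  simp only [map_smul, smul_apply, smul_eq_mul]
  rw [← mul_assoc, Real.sqrt_mul (mul_self_nonneg c), Real.sqrt_mul_self_eq_abs]

@[simp] theorem vnorm_zero : vnorm g (0 : TangentSpace (𝓡 n) x) = 0 := by simp [vnorm]

theorem continuous_vnorm :
    Continuous fun v : TangentBundle (𝓡 n) M => vnorm g v.2 := by
  refine Real.continuous_sqrt.comp ?_
  have h := Continuous.clm_bundle_apply₂ (F₁ := EuclideanSpace ℝ (Fin n))
    (F₂ := EuclideanSpace ℝ (Fin n)) (F₃ := ℝ) (E₁ := fun x : M => TangentSpace (𝓡 n) x)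
    (E₂ := fun x : M => TangentSpace (𝓡 n) x) (E₃ := Bundle.Trivial M ℝ)
    (b := fun v : TangentBundle (𝓡 n) M => v.1)
    (ψ := fun v => g.inner v.1) (v := fun v => v.2) (w := fun v => v.2)
    (g.contMDiff.continuous.comp (FiberBundle.continuous_proj _ _)) continuous_id continuous_id
  exact (continuous_snd.comp (Bundle.Trivial.homeomorphProd M ℝ).continuous).comp h

end Norm

/-! ### The Poincaré inequality and the lower bound for the tone -/

section Tone

variable {n : ℕ} {M : Type*} [TopologicalSpace M] [ChartedSpace (EuclideanSpace ℝ (Fin n)) M]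
  [IsManifold (𝓡 n) ∞ M]

theorem dirDeriv_abs_rpow (g : Metric n M) {φ : M → ℝ} {x : M}
    (hφ : MDifferentiableAt (𝓡 n) 𝓘(ℝ, ℝ) φ x) {p : ℝ} (hp : 1 < p) (X : VField n M) :
    dirDeriv (fun z => |φ z| ^ p) X x =
      p * |φ x| ^ (p - 2) * φ x * g.inner x (grad g φ x) (X x) := by
  have h := (hasDerivAt_abs_rpow (φ x) hp).hasFDerivAt.hasMFDerivAt.comp x hφ.hasMFDerivAt
  have h1 := h.mfderiv
  unfold dirDeriv
  rw [inner_grad]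
  have h2 := congrArg (fun L : TangentSpace (𝓡 n) x →L[ℝ] ℝ => L (X x)) h1
  refine h2.trans ?_
  exact mul_comm (dirDeriv φ X x) _

theorem abs_dirDeriv_abs_rpow_le (g : Metric n M) {φ : M → ℝ} {x : M}
    (hφ : MDifferentiableAt (𝓡 n) 𝓘(ℝ, ℝ) φ x) {p : ℝ} (hp : 1 < p) {X : VField n M} {B : ℝ}
    (hB : vnorm g (X x) ≤ B) :
    |dirDeriv (fun z => |φ z| ^ p) X x| ≤ p * |φ x| ^ (p - 1) * vnorm g (grad g φ x) * B := by
  rw [dirDeriv_abs_rpow g hφ hp, abs_mul]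
  have h1 : |p * |φ x| ^ (p - 2) * φ x| = p * |φ x| ^ (p - 1) := by
    rw [abs_mul, abs_mul, abs_of_pos (by linarith : 0 < p),
      abs_of_nonneg (Real.rpow_nonneg (abs_nonneg _) _), mul_assoc]
    congr 1
    -- At a zero of `φ` the exponent `p - 2` may be negative and the addition rule for powers fails;
    -- there both sides vanish because `p > 1`.
    rcases eq_or_ne (φ x) 0 with h0 | h0
    · rw [h0, abs_zero, mul_zero, Real.zero_rpow (by linarith)]
    · nth_rewrite 2 [← Real.rpow_one |φ x|]
      rw [← Real.rpow_add (abs_pos.2 h0)]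
      congr 1
      ring
  rw [h1, mul_assoc (p * |φ x| ^ (p - 1))]
  have hp0 : 0 ≤ p * |φ x| ^ (p - 1) :=
    mul_nonneg (by linarith) (Real.rpow_nonneg (abs_nonneg _) _)
  exact mul_le_mul_of_nonneg_left ((abs_inner_le g _ _).trans
    (mul_le_mul_of_nonneg_left hB (vnorm_nonneg g _))) hp0

/-- Young's inequality for `m^(p-1)` and `pBs/a` produces `(1 - 1/p) m^p`. Absorbing it leaves `m^p
/ p` on the left, and multiplication by `p` gives the stated constant. In the application `m = |φ|`,
`s = ‖∇φ‖` and `D = div(|φ|^p X)`. -/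
theorem rpow_le_of_le_young {p a B m s D : ℝ} (hp : 1 < p) (ha : 0 < a) (hB : 0 ≤ B) (hm : 0 ≤ m)
    (hs : 0 ≤ s) (h : a * m ^ p ≤ p * m ^ (p - 1) * s * B + D) :
    m ^ p - p / a * D ≤ (p * B / a) ^ p * s ^ p := by
  have hp0 : 0 < p := by linarith
  have hpq : (p.conjExponent).HolderConjugate p := (Real.HolderConjugate.conjExponent hp).symm
  have hy := Real.young_inequality_of_nonneg (a := m ^ (p - 1)) (b := p * B / a * s)
    (Real.rpow_nonneg hm _) (by positivity) hpq
  have h1 : (m ^ (p - 1)) ^ p.conjExponent = m ^ p := by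
    rw [← Real.rpow_mul hm]
    congr 1
    unfold Real.conjExponent
    have : p - 1 ≠ 0 := by linarith
    field_simp
  have h2 : m ^ p / p.conjExponent = m ^ p - m ^ p / p := by
    unfold Real.conjExponent
    have : p - 1 ≠ 0 := by linarith
    field_simp
  rw [h1, h2, Real.mul_rpow (by positivity) hs] at hy
  have h3 : a * (m ^ (p - 1) * (p * B / a * s)) = p * m ^ (p - 1) * s * B := by
    field_simp
  have h4 := mul_le_mul_of_nonneg_left hy ha.le
  rw [h3] at h4
  have h5 : a * (m ^ p / p) ≤ a * ((p * B / a) ^ p * s ^ p / p) + D := by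
    have : a * (m ^ p - m ^ p / p + (p * B / a) ^ p * s ^ p / p) =
      a * m ^ p - a * (m ^ p / p) + a * ((p * B / a) ^ p * s ^ p / p) := by ring
    linarith
  have h6 := mul_le_mul_of_nonneg_left h5 (div_nonneg hp0.le ha.le)
  have h7 : p / a * (a * (m ^ p / p)) = m ^ p := by field_simp
  have h8 : p / a * (a * ((p * B / a) ^ p * s ^ p / p) + D) =
    (p * B / a) ^ p * s ^ p + p / a * D := by field_simp
  linarith

variable [MeasurableSpace M] [BorelSpace M] [SecondCountableTopology M] [T2Space M]

/-- The `Lᵖ` Poincaré inequality for test functions given by a vector field with positive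
divergence. -/
theorem mass_le_energy_of_isTestFunction (g : Metric n M) {p : ℝ} (hp : 1 < p) {Ω : Set M}
    (hΩ : IsOpen Ω) {X : VField n M} (hX : ∀ x ∈ Ω, ContMDiffAt (𝓡 n) (𝓡 n).tangent ∞
      (fun x => (⟨x, X x⟩ : TangentBundle (𝓡 n) M)) x) {a B : ℝ} (ha : 0 < a) (hB0 : 0 ≤ B)
    (hdiv : ∀ x ∈ Ω, a ≤ divergence g X x) (hB : ∀ x ∈ Ω, vnorm g (X x) ≤ B) {φ : M → ℝ}
    (hφ : IsTestFunction n Ω φ) :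
    mass g p Ω φ ≤ ENNReal.ofReal ((p * B / a) ^ p) * energy g p Ω (grad g φ) := by
  set u : M → ℝ := fun z => |φ z| ^ p
  have hp0 : 0 < p := by linarith
  have hu : ContMDiff (𝓡 n) 𝓘(ℝ, ℝ) 1 u := by
    have h1 : ContDiff ℝ 1 fun x : ℝ => |x| ^ p := contDiff_norm_rpow hp
    exact h1.contMDiff.comp (hφ.smooth.of_le (by norm_cast))
  have hu0 : (fun t : ℝ => |t| ^ p) 0 = 0 := by simp [Real.zero_rpow hp0.ne']
  have hsub : tsupport u ⊆ tsupport φ := closure_mono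
    (Function.support_comp_subset (g := fun t : ℝ => |t| ^ p) hu0 φ)
  have huc : HasCompactSupport u := hφ.compact.comp_left (g := fun t : ℝ => |t| ^ p) hu0
  have hus : tsupport u ⊆ Ω := hsub.trans hφ.supp
  have hD := integral_divSMul_eq_zero g hΩ hX hu huc hus
  have hDi : Integrable (divSMul g X u) (riemVolume g) :=
    (continuous_divSMul g hΩ hX hu hus).integrable_of_hasCompactSupport
      (hasCompactSupport_divSMul g X huc)
  have hui : Integrable u (riemVolume g) :=
    hu.continuous.integrable_of_hasCompactSupport huc
  have hDΩ : ∫ z in Ω, divSMul g X u z ∂(riemVolume g) = 0 := by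
    rw [setIntegral_eq_integral_of_forall_compl_eq_zero, hD]
    exact fun z hz => divSMul_eq_zero g X fun h => hz (hus h)
  have hmass : mass g p Ω φ = ENNReal.ofReal (∫ z in Ω, u z ∂(riemVolume g)) := by
    rw [ofReal_integral_eq_lintegral_ofReal hui.restrict
      (.of_forall fun z => Real.rpow_nonneg (abs_nonneg _) _)]
    exact lintegral_congr fun z => ENNReal.ofReal_rpow_of_nonneg (abs_nonneg _) hp0.le
  -- Subtracting a multiple of a divergence of integral zero leaves the integral unchanged and makes
  -- the pointwise Young estimate applicable.
  have hw : ∫ z in Ω, u z ∂(riemVolume g) =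
      ∫ z in Ω, (u z - p / a * divSMul g X u z) ∂(riemVolume g) := by
    rw [integral_sub hui.restrict (hDi.restrict.const_mul _), integral_const_mul, hDΩ, mul_zero,
      sub_zero]
  rw [hmass, hw]
  refine (ofReal_integral_le_lintegral_ofReal
    (hui.restrict.sub (hDi.restrict.const_mul _))).trans ?_
  unfold energy
  rw [← lintegral_const_mul' _ _ (by simp)]
  refine setLIntegral_mono_ae' hΩ.measurableSet (.of_forall fun x hx => ?_)
  rw [ENNReal.ofReal_rpow_of_nonneg (vnorm_nonneg g _) hp0.le, ← ENNReal.ofReal_mul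
    (Real.rpow_nonneg (div_nonneg (mul_nonneg hp0.le hB0) ha.le) _)]
  refine ENNReal.ofReal_le_ofReal (rpow_le_of_le_young hp ha hB0 (abs_nonneg _)
    (vnorm_nonneg g _) ?_)
  have h1 := abs_dirDeriv_abs_rpow_le g (hφ.smooth.mdifferentiable (by simp) x) hp (hB x hx)
  have h2 : a * u x ≤ u x * divergence g X x := by
    rw [mul_comm]
    exact mul_le_mul_of_nonneg_left (hdiv x hx) (Real.rpow_nonneg (abs_nonneg _) _)
  have h3 := (abs_le.1 h1).1
  change a * u x ≤ _ + (u x * divergence g X x + dirDeriv u X x)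
  change -_ ≤ dirDeriv u X x at h3
  linarith

/-- The `Lᵖ` Poincaré inequality on `W₀^{1,p}`. -/
theorem mass_le_energy (g : Metric n M) {p : ℝ} (hp : 1 < p) {Ω : Set M}
    (hΩ : IsOpen Ω) {X : VField n M} (hX : ∀ x ∈ Ω, ContMDiffAt (𝓡 n) (𝓡 n).tangent ∞
      (fun x => (⟨x, X x⟩ : TangentBundle (𝓡 n) M)) x) {a B : ℝ} (ha : 0 < a) (hB0 : 0 ≤ B)
    (hdiv : ∀ x ∈ Ω, a ≤ divergence g X x) (hB : ∀ x ∈ Ω, vnorm g (X x) ≤ B) {f : M → ℝ}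
    {V : VField n M} (hf : IsSobolevZero g p Ω f V) :
    mass g p Ω f ≤ ENNReal.ofReal ((p * B / a) ^ p) * energy g p Ω V := by
  obtain ⟨φ, hφ, hlim⟩ := hf.approx
  set C := ENNReal.ofReal ((p * B / a) ^ p)
  set δ := fun k => mass g p Ω (fun x => φ k x - f x) +
    energy g p Ω (fun x => grad g (φ k) x - V x)
  have hVm : AEMeasurable (fun x => ENNReal.ofReal (vnorm g (V x))) ((riemVolume g).restrict Ω) :=
    ((continuous_vnorm g).comp_aestronglyMeasurable hf.measurable_grad).aemeasurable.ennreal_ofReal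
  -- Compare `f` with `φₖ`, apply the inequality to `φₖ`, and compare `∇φₖ` with `V`. The measurable
  -- function in the two comparisons is `|φₖ|` and then `‖V‖`, so the differences need no
  -- measurability.
  have hk : ∀ t : ℝ, 0 < t → t < 1 → ∀ k, mass g p Ω f ≤
      ENNReal.ofReal ((1 - t) ^ (1 - p)) * (C * (ENNReal.ofReal ((1 - t) ^ (1 - p)) *
        energy g p Ω V + ENNReal.ofReal (t ^ (1 - p)) * δ k)) +
        ENNReal.ofReal (t ^ (1 - p)) * δ k := by
    intro t ht0 ht1 k
    have h1 : mass g p Ω f ≤ ENNReal.ofReal ((1 - t) ^ (1 - p)) * mass g p Ω (φ k) +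
        ENNReal.ofReal (t ^ (1 - p)) * mass g p Ω (fun x => φ k x - f x) := by
      refine lintegral_rpow_le_of_le_add hp.le ht0 ht1
        (hφ k).smooth.continuous.abs.measurable.ennreal_ofReal.aemeasurable fun x => ?_
      rw [← ENNReal.ofReal_add (abs_nonneg _) (abs_nonneg _)]
      refine ENNReal.ofReal_le_ofReal ?_
      have := abs_sub (φ k x) (φ k x - f x)
      rwa [sub_sub_cancel] at this
    have h2 : energy g p Ω (grad g (φ k)) ≤ ENNReal.ofReal ((1 - t) ^ (1 - p)) * energy g p Ω V +
        ENNReal.ofReal (t ^ (1 - p)) * energy g p Ω (fun x => grad g (φ k) x - V x) := by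
      refine lintegral_rpow_le_of_le_add hp.le ht0 ht1 hVm fun x => ?_
      rw [← ENNReal.ofReal_add (vnorm_nonneg g _) (vnorm_nonneg g _)]
      refine ENNReal.ofReal_le_ofReal ?_
      have := vnorm_add_le g (V x) (grad g (φ k) x - V x)
      rwa [add_sub_cancel] at this
    have h3 := mass_le_energy_of_isTestFunction g hp hΩ hX ha hB0 hdiv hB (hφ k)
    refine h1.trans ?_
    gcongr
    · refine h3.trans ?_
      gcongr
      refine h2.trans ?_
      gcongr
      exact le_add_self
    · exact le_self_add
  have ht : ∀ t : ℝ, 0 < t → t < 1 → mass g p Ω f ≤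
      ENNReal.ofReal ((1 - t) ^ (1 - p)) * (C * (ENNReal.ofReal ((1 - t) ^ (1 - p)) *
        energy g p Ω V)) := by
    intro t ht0 ht1
    -- The limit in `k` is taken at fixed `t`, since `t^(1-p)` blows up as `t → 0`; only afterwards
    -- does `t → 0` send the remaining factors `(1-t)^(1-p)` to 1.
    refine ge_of_tendsto' (x := Filter.atTop) ?_ (hk t ht0 ht1)
    have h1 := ENNReal.Tendsto.const_mul (a := ENNReal.ofReal (t ^ (1 - p))) hlim
      (Or.inr ENNReal.ofReal_ne_top)
    have h2 := ENNReal.Tendsto.const_mul (a := ENNReal.ofReal ((1 - t) ^ (1 - p)))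
      (ENNReal.Tendsto.const_mul (a := C) (h1.const_add (ENNReal.ofReal ((1 - t) ^ (1 - p)) *
        energy g p Ω V)) (Or.inr ENNReal.ofReal_ne_top)) (Or.inr ENNReal.ofReal_ne_top)
    simpa using h2.add h1
  have hlim1 : Filter.Tendsto (fun t : ℝ => ENNReal.ofReal ((1 - t) ^ (1 - p)))
      (nhdsWithin 0 (Set.Ioi 0)) (nhds 1) := by
    have h1 : ContinuousAt (fun t : ℝ => ENNReal.ofReal ((1 - t) ^ (1 - p))) 0 := by
      refine ENNReal.continuous_ofReal.continuousAt.comp ?_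
      exact (continuousAt_const.sub continuousAt_id).rpow_const (Or.inl (by simp))
    have h2 := h1.tendsto
    simp only [sub_zero, Real.one_rpow, ENNReal.ofReal_one] at h2
    exact h2.mono_left nhdsWithin_le_nhds
  have hlim2 := ENNReal.Tendsto.mul hlim1 (Or.inl one_ne_zero)
    (ENNReal.Tendsto.const_mul (a := C) (ENNReal.Tendsto.mul_const (b := energy g p Ω V) hlim1
      (Or.inl one_ne_zero)) (Or.inr ENNReal.ofReal_ne_top)) (Or.inr ENNReal.one_ne_top)
  rw [one_mul, one_mul] at hlim2
  refine ge_of_tendsto hlim2 ?_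
  filter_upwards [Ioo_mem_nhdsGT (zero_lt_one' ℝ)] with t ht' using ht t ht'.1 ht'.2

theorem cConst_rpow_div_le_fundamentalTone (g : Metric n M) {p : ℝ} (hp : 1 < p) {Ω : Set M}
    (hΩ : IsOpen Ω) (hne : Ω.Nonempty) :
    cConst g Ω ^ p / ENNReal.ofReal p ^ p ≤ fundamentalTone g p Ω := by
  have hp0 : 0 < p := by linarith
  refine le_iInf fun f => le_iInf fun V => le_iInf fun hf => le_iInf fun hne0 => ?_
  set T := energy g p Ω V / mass g p Ω f
  have hm0 : mass g p Ω f ≠ 0 := by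
    intro h0
    refine hne0 ?_
    have hmeas : AEMeasurable (fun x => ENNReal.ofReal |f x| ^ p) ((riemVolume g).restrict Ω) :=
      (hf.measurable_fun.aemeasurable.abs.ennreal_ofReal).pow_const p
    filter_upwards [(lintegral_eq_zero_iff' hmeas).1 h0] with x hx
    have := (ENNReal.rpow_eq_zero_iff_of_pos hp0).1 hx
    simpa using this
  refine ENNReal.div_le_of_le_mul' ?_
  -- Taking the `p`-th root first reduces the bound on the supremum to a bound for each single
  -- field.
  suffices h : cConst g Ω ≤ (ENNReal.ofReal p ^ p * T) ^ p⁻¹ by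
    calc cConst g Ω ^ p ≤ ((ENNReal.ofReal p ^ p * T) ^ p⁻¹) ^ p :=
          ENNReal.rpow_le_rpow h hp0.le
      _ = ENNReal.ofReal p ^ p * T := ENNReal.rpow_inv_rpow hp0.ne' _
  refine iSup_le fun X => iSup_le fun hX => ?_
  obtain ⟨C, hC⟩ := hX.bounded
  obtain ⟨d, hd0, hd⟩ := hX.div_pos
  obtain ⟨x₀, hx₀⟩ := hne
  set A : ℝ≥0∞ := ⨅ x ∈ Ω, ENNReal.ofReal (divergence g X x)
  set S : ℝ≥0∞ := ⨆ x ∈ Ω, ENNReal.ofReal (vnorm g (X x))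
  have hAtop : A ≠ ⊤ := ((iInf₂_le x₀ hx₀).trans_lt ENNReal.ofReal_lt_top).ne
  have hA0 : A ≠ 0 := by
    have : ENNReal.ofReal d ≤ A := le_iInf₂ fun x hx => ENNReal.ofReal_le_ofReal (hd x hx)
    exact ((ENNReal.ofReal_pos.2 hd0).trans_le this).ne'
  have hStop : S ≠ ⊤ := by
    have : S ≤ ENNReal.ofReal C := iSup₂_le fun x hx => ENNReal.ofReal_le_ofReal (hC x hx)
    exact (this.trans_lt ENNReal.ofReal_lt_top).ne
  have ha : 0 < A.toReal := ENNReal.toReal_pos hA0 hAtop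
  have hmain := mass_le_energy g hp hΩ (fun x hx => (hX.smooth x hx).contMDiffAt (hΩ.mem_nhds hx))
    ha (B := S.toReal) ENNReal.toReal_nonneg (fun x hx => by
      have h1 : A ≤ ENNReal.ofReal (divergence g X x) := iInf₂_le x hx
      refine (ENNReal.toReal_mono ENNReal.ofReal_ne_top h1).trans_eq ?_
      exact ENNReal.toReal_ofReal (hd0.le.trans (hd x hx)))
    (fun x hx => by
      have h1 : ENNReal.ofReal (vnorm g (X x)) ≤ S :=
        le_iSup₂ (f := fun x (_ : x ∈ Ω) => ENNReal.ofReal (vnorm g (X x))) x hx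
      refine le_trans ?_ (ENNReal.toReal_mono hStop h1)
      exact (ENNReal.toReal_ofReal (vnorm_nonneg g _)).ge) hf
  have hconst : ENNReal.ofReal ((p * S.toReal / A.toReal) ^ p) = (ENNReal.ofReal p * S / A) ^ p := by
    rw [← ENNReal.ofReal_rpow_of_nonneg (by positivity) hp0.le, ENNReal.ofReal_div_of_pos ha,
      ENNReal.ofReal_mul hp0.le, ENNReal.ofReal_toReal hStop, ENNReal.ofReal_toReal hAtop]
  rw [hconst] at hmain
  -- With `S = 0` the Poincaré inequality would force the mass of `f` to vanish.
  have hS0 : S ≠ 0 := by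
    intro h0
    rw [h0, mul_zero, ENNReal.zero_div, ENNReal.zero_rpow_of_pos hp0, zero_mul] at hmain
    exact hm0 (le_antisymm hmain bot_le)
  rw [ENNReal.le_rpow_inv_iff hp0]
  have h1 : 1 ≤ (ENNReal.ofReal p * S / A) ^ p * T := by
    rw [← ENNReal.div_self hm0 hf.mass_lt_top.ne, ← mul_div_assoc]
    gcongr
  calc (A / S) ^ p = (A / S) ^ p * 1 := (mul_one _).symm
    _ ≤ (A / S) ^ p * ((ENNReal.ofReal p * S / A) ^ p * T) := by gcongr
    _ = ENNReal.ofReal p ^ p * T := by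
      rw [← mul_assoc, ← ENNReal.mul_rpow_of_nonneg _ _ hp0.le]
      congr 2
      have h2 : A / S * (ENNReal.ofReal p * S / A) =
          ENNReal.ofReal p * (S * S⁻¹) * (A * A⁻¹) := by
        simp only [div_eq_mul_inv]
        ring
      rw [h2, ENNReal.mul_inv_cancel hS0 hStop, ENNReal.mul_inv_cancel hA0 hAtop, mul_one, mul_one]

end Tone

/-! ### A radial barrier field in Euclidean space -/

/-- A radial vector field, supported in a closed ball, whose divergence is nonnegative away from
the centre. -/
def hopfField {n : ℕ} (lam R : ℝ) (c y : EuclideanSpace ℝ (Fin n)) : EuclideanSpace ℝ (Fin n) :=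
  (-(Real.exp (-lam * ‖y - c‖ ^ 2) * expNegInvGlue (R ^ 2 - ‖y - c‖ ^ 2))) • (y - c)

section Hopf

variable {n : ℕ} {lam R : ℝ} {c y : EuclideanSpace ℝ (Fin n)}

theorem contDiff_hopfField : ContDiff ℝ ∞ (hopfField lam R c) := by
  have h1 : ContDiff ℝ ∞ fun y : EuclideanSpace ℝ (Fin n) => ‖y - c‖ ^ 2 :=
    (contDiff_id.sub contDiff_const).norm_sq ℝ
  exact (((contDiff_const.mul h1).exp).mul
    ((expNegInvGlue.contDiff (n := ⊤)).comp (contDiff_const.sub h1))).neg.smul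
    (contDiff_id.sub contDiff_const)

theorem hopfField_eq_zero (hR : 0 ≤ R) (hy : y ∉ Metric.closedBall c R) :
    hopfField lam R c y = 0 := by
  have h : R < ‖y - c‖ := by simpa [dist_eq_norm] using hy
  unfold hopfField
  rw [expNegInvGlue.zero_of_nonpos (by nlinarith), mul_zero, neg_zero, zero_smul]

/-- For `h(y)(y - c)` the divergence is `n h + dh(y - c)`. The field points inward, so `n h` has the
bad sign, while both the exponential and the cutoff decrease outward and contribute the positive
terms. -/
theorem trace_fderiv_hopfField :
    LinearMap.trace ℝ _ (fderiv ℝ (hopfField lam R c) y : EuclideanSpace ℝ (Fin n) →ₗ[ℝ] _) =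
      Real.exp (-lam * ‖y - c‖ ^ 2) * ((2 * lam * ‖y - c‖ ^ 2 - n) *
        expNegInvGlue (R ^ 2 - ‖y - c‖ ^ 2) +
        2 * ‖y - c‖ ^ 2 * deriv expNegInvGlue (R ^ 2 - ‖y - c‖ ^ 2)) := by
  have h0 : HasFDerivAt (fun y : EuclideanSpace ℝ (Fin n) => y - c) (.id ℝ _) y :=
    (hasFDerivAt_id y).sub_const c
  have h1 := h0.norm_sq
  have hg : HasDerivAt expNegInvGlue (deriv expNegInvGlue (R ^ 2 - ‖y - c‖ ^ 2))
      (R ^ 2 - ‖y - c‖ ^ 2) :=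
    ((expNegInvGlue.contDiff (n := ⊤)).differentiable (by simp) _).hasDerivAt
  have h2 := ((h1.const_mul (-lam)).exp.mul (hg.comp_hasFDerivAt y (h1.const_sub (R ^ 2)))).neg
  have h3 := (h2.smul h0).fderiv
  change fderiv ℝ (hopfField lam R c) y = _ at h3
  have htr : ∀ L : EuclideanSpace ℝ (Fin n) →L[ℝ] ℝ, ∀ w : EuclideanSpace ℝ (Fin n),
      LinearMap.trace ℝ _ (L.smulRight w : EuclideanSpace ℝ (Fin n) →ₗ[ℝ] _) = L w :=
    fun L w => LinearMap.trace_smulRight _ _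
  have hid : LinearMap.trace ℝ (EuclideanSpace ℝ (Fin n))
      (ContinuousLinearMap.id ℝ (EuclideanSpace ℝ (Fin n)) : EuclideanSpace ℝ (Fin n) →ₗ[ℝ] _) =
      n := by
    have := LinearMap.trace_id ℝ (EuclideanSpace ℝ (Fin n))
    rwa [finrank_euclideanSpace_fin] at this
  rw [h3, ContinuousLinearMap.toLinearMap_add, map_add, ContinuousLinearMap.toLinearMap_smul,
    map_smul, htr, hid]
  simp only [Function.comp_apply, Pi.neg_apply, Pi.mul_apply]
  generalize y - c = w
  simp
  ring

theorem deriv_expNegInvGlue_nonneg (x : ℝ) : 0 ≤ deriv expNegInvGlue x :=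
  expNegInvGlue.monotone.deriv_nonneg

/-- With `lam = (n + 1)/ε²`, distance at least `ε` gives `lam ‖y - c‖² ≥ n + 1`, which beats the
term `-n`. The sign is strict inside the ball because the cutoff is positive there. -/
theorem trace_fderiv_hopfField_nonneg {ε : ℝ} (hε : 0 < ε) (hy : ε ≤ ‖y - c‖) :
    0 ≤ LinearMap.trace ℝ _ (fderiv ℝ (hopfField ((n + 1) / ε ^ 2) R c) y :
      EuclideanSpace ℝ (Fin n) →ₗ[ℝ] _) ∧
    (‖y - c‖ < R → 0 < LinearMap.trace ℝ _ (fderiv ℝ (hopfField ((n + 1) / ε ^ 2) R c) y :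
      EuclideanSpace ℝ (Fin n) →ₗ[ℝ] _)) := by
  rw [trace_fderiv_hopfField]
  have h1 : 0 < 2 * ((n + 1 : ℝ) / ε ^ 2) * ‖y - c‖ ^ 2 - n := by
    have h2 : (n + 1 : ℝ) ≤ (n + 1) / ε ^ 2 * ‖y - c‖ ^ 2 := by
      rw [div_mul_eq_mul_div, le_div_iff₀ (by positivity)]
      gcongr
    have : (0 : ℝ) ≤ n := n.cast_nonneg
    linarith
  have h3 : 0 ≤ 2 * ‖y - c‖ ^ 2 * deriv expNegInvGlue (R ^ 2 - ‖y - c‖ ^ 2) :=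
    mul_nonneg (by positivity) (deriv_expNegInvGlue_nonneg _)
  refine ⟨mul_nonneg (Real.exp_nonneg _) (add_nonneg (mul_nonneg h1.le
    (expNegInvGlue.nonneg _)) h3), fun hR => mul_pos (Real.exp_pos _) (add_pos_of_pos_of_nonneg
    (mul_pos h1 (expNegInvGlue.pos_of_pos ?_)) h3)⟩
  nlinarith [norm_nonneg (y - c)]

end Hopf

theorem isClosed_symm_image {M E : Type*} [TopologicalSpace M] [TopologicalSpace E] [T2Space M]
    {e : OpenPartialHomeomorph M E} {K : Set E} (hK : IsCompact K) (hKt : K ⊆ e.target) :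
    IsClosed (e.symm '' K) :=
  (hK.image_of_continuousOn (e.continuousOn_symm.mono hKt)).isClosed

/-! ### Local calculus of vector fields and fields supported in a chart -/

section Fields

variable {n : ℕ} {M : Type*} [TopologicalSpace M] [ChartedSpace (EuclideanSpace ℝ (Fin n)) M]
  [IsManifold (𝓡 n) ∞ M]

/-- Smoothness of a vector field at a point. -/
def SmoothAt (X : VField n M) (x : M) : Prop :=
  ContMDiffAt (𝓡 n) (𝓡 n).tangent ∞ (fun x => (⟨x, X x⟩ : TangentBundle (𝓡 n) M)) x

theorem SmoothAt.congr {X Y : VField n M} {x : M} (hX : SmoothAt X x)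
    (h : ∀ᶠ z in nhds x, X z = Y z) : SmoothAt Y x := by
  refine ContMDiffAt.congr_of_eventuallyEq hX ?_
  filter_upwards [h] with z hz
  rw [hz]

theorem smoothAt_zero (x : M) : SmoothAt (0 : VField n M) x :=
  Bundle.contMDiffAt_zeroSection ℝ (fun x : M => TangentSpace (𝓡 n) x)

theorem SmoothAt.add {X Y : VField n M} {x : M} (hX : SmoothAt X x) (hY : SmoothAt Y x) :
    SmoothAt (X + Y) x :=
  ContMDiffAt.add_section hX hY

theorem SmoothAt.const_smul {X : VField n M} {x : M} (hX : SmoothAt X x) (a : ℝ) :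
    SmoothAt (a • X) x :=
  ContMDiffAt.const_smul_section hX

/-- The divergence depends only on the germ of the field; no smoothness is needed. This handles
fields defined by cases. -/
theorem divergence_congr (g : Metric n M) {X Y : VField n M} {x : M}
    (h : ∀ᶠ z in nhds x, X z = Y z) : divergence g X x = divergence g Y x := by
  unfold divergence
  congr 1
  refine Finset.sum_congr rfl fun i _ => ?_
  rw [Filter.EventuallyEq.fderiv_eq]
  have h1 : Filter.Tendsto (extChartAt (𝓡 n) x).symm (nhds (extChartAt (𝓡 n) x x)) (nhds x) := by
    have := (continuousAt_extChartAt_symm (I := 𝓡 n) x).tendsto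
    rwa [extChartAt_to_inv] at this
  filter_upwards [h1.eventually h] with y hy
  unfold coordComp
  rw [hy]

theorem divergence_zero (g : Metric n M) (x : M) : divergence g (0 : VField n M) x = 0 := by
  have h : ∀ i : Fin n, (fun y => density g x y * coordComp (0 : VField n M) x i y) =
      fun _ => 0 := by
    intro i
    funext y
    unfold coordComp
    simp only [Pi.zero_apply, map_zero]
    exact mul_zero _
  unfold divergence
  simp [h]

theorem divergence_add (g : Metric n M) {X Y : VField n M} {x : M} (hX : SmoothAt X x)
    (hY : SmoothAt Y x) :
    divergence g (X + Y) x = divergence g X x + divergence g Y x := by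
  have he := IsManifold.chart_mem_maximalAtlas (I := 𝓡 n) (n := ∞) x
  have hx := mem_chart_source (EuclideanSpace ℝ (Fin n)) x
  have h1 := (contDiffAt_weightedComp g he hx hX).differentiableAt (by simp)
  have h2 := (contDiffAt_weightedComp g he hx hY).differentiableAt (by simp)
  have h3 : weightedComp g (chartAt (EuclideanSpace ℝ (Fin n)) x) (X + Y) =
      weightedComp g (chartAt (EuclideanSpace ℝ (Fin n)) x) X +
      weightedComp g (chartAt (EuclideanSpace ℝ (Fin n)) x) Y := by
    funext y
    simp only [weightedComp, chartComp, Pi.add_apply, map_add, smul_add]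
  rw [divergence_eq_chartAt g (hX.add hY), divergence_eq_chartAt g hX, divergence_eq_chartAt g hY,
    h3, fderiv_add h1 h2, ContinuousLinearMap.toLinearMap_add, map_add, mul_add]

theorem divergence_const_smul (g : Metric n M) {X : VField n M} {x : M} (hX : SmoothAt X x)
    (a : ℝ) : divergence g (a • X) x = a * divergence g X x := by
  have he := IsManifold.chart_mem_maximalAtlas (I := 𝓡 n) (n := ∞) x
  have hx := mem_chart_source (EuclideanSpace ℝ (Fin n)) x
  have h1 := (contDiffAt_weightedComp g he hx hX).differentiableAt (by simp)
  have h3 : weightedComp g (chartAt (EuclideanSpace ℝ (Fin n)) x) (a • X) =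
      a • weightedComp g (chartAt (EuclideanSpace ℝ (Fin n)) x) X := by
    funext y
    simp only [weightedComp, chartComp, Pi.smul_apply, map_smul]
    rw [smul_comm]
  rw [divergence_eq_chartAt g (hX.const_smul a), divergence_eq_chartAt g hX,
    h3, fderiv_const_smul h1, ContinuousLinearMap.toLinearMap_smul, map_smul, smul_eq_mul]
  ring

open Classical in
/-- The vector field on a manifold that is supported in the domain of a chart and has the
coordinate expression `Z`, divided by the Riemannian density. -/
def chartField (g : Metric n M) (e : OpenPartialHomeomorph M (EuclideanSpace ℝ (Fin n)))
    (Z : EuclideanSpace ℝ (Fin n) → EuclideanSpace ℝ (Fin n)) : VField n M := fun x =>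
  if x ∈ e.source then frame e x ((volDens g e x)⁻¹ • Z (e x)) else 0

section ChartField

variable (g : Metric n M) {e : OpenPartialHomeomorph M (EuclideanSpace ℝ (Fin n))}
  {Z : EuclideanSpace ℝ (Fin n) → EuclideanSpace ℝ (Fin n)} {K : Set (EuclideanSpace ℝ (Fin n))}

theorem smoothAt_chartField_of_mem_source (he : e ∈ IsManifold.maximalAtlas (𝓡 n) ∞ M)
    (hZ : ContDiff ℝ ∞ Z) {x : M} (hx : x ∈ e.source) : SmoothAt (chartField g e Z) x := by
  have h1 : ContDiffAt ℝ ∞ (fun y => (volDens g e (e.symm y))⁻¹ • Z y) (e x) := by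
    refine ((contDiffAt_volDens g he hx).inv ?_).smul hZ.contDiffAt
    rw [e.left_inv hx]
    exact (volDens_pos g he hx).ne'
  refine ContMDiffAt.congr_of_eventuallyEq (contMDiffAt_frame he hx h1) ?_
  filter_upwards [e.open_source.mem_nhds hx] with z hz
  simp only [chartField, if_pos hz, e.left_inv hz]

/-- Division by the density makes the weighted component exactly `Z`, so the Riemannian divergence
has the sign of the Euclidean one. -/
theorem divergence_chartField (he : e ∈ IsManifold.maximalAtlas (𝓡 n) ∞ M)
    (hZ : ContDiff ℝ ∞ Z) {x : M} (hx : x ∈ e.source) :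
    divergence g (chartField g e Z) x = (volDens g e x)⁻¹ * LinearMap.trace ℝ _
      (fderiv ℝ Z (e x) : EuclideanSpace ℝ (Fin n) →ₗ[ℝ] EuclideanSpace ℝ (Fin n)) := by
  rw [divergence_eq g he hx (smoothAt_chartField_of_mem_source g he hZ hx)]
  have h : weightedComp g e (chartField g e Z) =ᶠ[nhds (e x)] Z := by
    filter_upwards [e.open_target.mem_nhds (e.map_source hx)] with y hy
    have hs := e.map_target hy
    unfold weightedComp chartComp chartField
    rw [if_pos hs, dchart_frame he hs, smul_smul, mul_inv_cancel₀ (volDens_pos g he hs).ne',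
      one_smul, e.right_inv hy]
  rw [h.fderiv_eq]

theorem chartField_eq_zero (hZ0 : ∀ y, y ∉ K → Z y = 0) {x : M} (hx : x ∉ e.symm '' K) :
    chartField g e Z x = 0 := by
  unfold chartField
  split_ifs with h
  · rw [hZ0 _ fun hK => hx ⟨_, hK, e.left_inv h⟩, smul_zero, map_zero]
  · rfl

variable [T2Space M]

/-- The compact set `e.symm '' K` is closed in a Hausdorff space, so its complement is a
neighbourhood of each point outside the source. -/
theorem eventually_chartField_eq_zero (hK : IsCompact K) (hKt : K ⊆ e.target)
    (hZ0 : ∀ y, y ∉ K → Z y = 0) {x : M} (hx : x ∉ e.source) :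
    ∀ᶠ z in nhds x, chartField g e Z z = 0 := by
  have h : x ∉ e.symm '' K := by
    rintro ⟨y, hy, rfl⟩
    exact hx (e.map_target (hKt hy))
  filter_upwards [(isClosed_symm_image hK hKt).isOpen_compl.mem_nhds h] with z hz
  exact chartField_eq_zero g hZ0 hz

theorem smoothAt_chartField (he : e ∈ IsManifold.maximalAtlas (𝓡 n) ∞ M) (hZ : ContDiff ℝ ∞ Z)
    (hK : IsCompact K) (hKt : K ⊆ e.target) (hZ0 : ∀ y, y ∉ K → Z y = 0) (x : M) :
    SmoothAt (chartField g e Z) x := by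
  by_cases hx : x ∈ e.source
  · exact smoothAt_chartField_of_mem_source g he hZ hx
  · refine (smoothAt_zero x).congr ?_
    filter_upwards [eventually_chartField_eq_zero g hK hKt hZ0 hx] with z hz using hz.symm

theorem divergence_chartField_of_notMem (hK : IsCompact K) (hKt : K ⊆ e.target)
    (hZ0 : ∀ y, y ∉ K → Z y = 0) {x : M} (hx : x ∉ e.source) :
    divergence g (chartField g e Z) x = 0 := by
  rw [divergence_congr g (Y := 0) (eventually_chartField_eq_zero g hK hKt hZ0 hx),
    divergence_zero]

theorem exists_vnorm_chartField_le (he : e ∈ IsManifold.maximalAtlas (𝓡 n) ∞ M)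
    (hZ : ContDiff ℝ ∞ Z) (hK : IsCompact K) (hKt : K ⊆ e.target)
    (hZ0 : ∀ y, y ∉ K → Z y = 0) : ∃ C, ∀ x, vnorm g (chartField g e Z x) ≤ C := by
  have hc : Continuous fun x => vnorm g (chartField g e Z x) :=
    (continuous_vnorm g).comp (continuous_iff_continuousAt.2 fun x =>
      (smoothAt_chartField g he hZ hK hKt hZ0 x).continuousAt)
  obtain ⟨C, hC⟩ := (hK.image_of_continuousOn
    (e.continuousOn_symm.mono hKt)).exists_bound_of_continuousOn hc.continuousOn
  refine ⟨max C 0, fun x => ?_⟩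
  by_cases hx : x ∈ e.symm '' K
  · exact le_max_of_le_left ((le_abs_self _).trans (hC x hx))
  · rw [chartField_eq_zero g hZ0 hx, vnorm_zero]
    exact le_max_right _ _

theorem exists_le_divergence_chartField (he : e ∈ IsManifold.maximalAtlas (𝓡 n) ∞ M)
    (hZ : ContDiff ℝ ∞ Z) (hK : IsCompact K) (hKt : K ⊆ e.target)
    (hZ0 : ∀ y, y ∉ K → Z y = 0) :
    ∃ C, 0 ≤ C ∧ ∀ x, -C ≤ divergence g (chartField g e Z) x := by
  have hs := smoothAt_chartField g he hZ hK hKt hZ0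
  have hc : Continuous (divergence g (chartField g e Z)) :=
    continuous_iff_continuousAt.2 fun x => continuousAt_divergence g (.of_forall hs)
  obtain ⟨C, hC⟩ := (hK.image_of_continuousOn
    (e.continuousOn_symm.mono hKt)).exists_bound_of_continuousOn hc.continuousOn
  refine ⟨max C 0, le_max_right _ _, fun x => ?_⟩
  by_cases hx : x ∈ e.symm '' K
  · exact (neg_le_neg (le_max_left C 0)).trans (neg_le_of_abs_le (hC x hx))
  · rw [divergence_congr g (Y := 0), divergence_zero]
    · simp
    · filter_upwards [(isClosed_symm_image hK hKt).isOpen_compl.mem_nhds hx] with z hz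
      exact chartField_eq_zero g hZ0 hz

end ChartField

/-! ### Propagation of expanding fields and positivity of the constant -/

/-- There is a bounded smooth vector field on `Ω` with nonnegative divergence on `Ω` and divergence
bounded below by a positive constant on `s ∩ Ω`. -/
def HasExpandingField (g : Metric n M) (Ω s : Set M) : Prop :=
  ∃ X : VField n M, (∀ x ∈ Ω, SmoothAt X x) ∧ (∃ C, ∀ x ∈ Ω, vnorm g (X x) ≤ C) ∧
    (∀ x ∈ Ω, 0 ≤ divergence g X x) ∧ ∃ δ, 0 < δ ∧ ∀ x ∈ s ∩ Ω, δ ≤ divergence g X x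

/-- Because the divergences are nonnegative on all of `Ω`, adding two fields preserves the positive
lower bound of each; compactness reduces the claim to finite sums. -/
theorem hasExpandingField_of_isCompact (g : Metric n M) {Ω s : Set M} (hs : IsCompact s)
    (h : ∀ x ∈ s, ∃ N ∈ nhds x, HasExpandingField g Ω N) : HasExpandingField g Ω s := by
  refine hs.induction_on (p := HasExpandingField g Ω) ?_ ?_ ?_ ?_
  · exact ⟨0, fun x _ => smoothAt_zero x, ⟨0, fun x _ => by simp⟩,
      fun x _ => (divergence_zero g x).ge, 1, one_pos, fun x hx => hx.1.elim⟩
  · rintro s t hst ⟨X, h1, h2, h3, δ, hδ, h4⟩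
    exact ⟨X, h1, h2, h3, δ, hδ, fun x hx => h4 x ⟨hst hx.1, hx.2⟩⟩
  · rintro s t ⟨X, h1, ⟨C, h2⟩, h3, δ, hδ, h4⟩ ⟨X', h1', ⟨C', h2'⟩, h3', δ', hδ', h4'⟩
    refine ⟨X + X', fun x hx => (h1 x hx).add (h1' x hx), ⟨C + C', fun x hx => ?_⟩, fun x hx => ?_,
      min δ δ', lt_min hδ hδ', fun x hx => ?_⟩
    · exact (vnorm_add_le g _ _).trans (add_le_add (h2 x hx) (h2' x hx))
    · rw [divergence_add g (h1 x hx) (h1' x hx)]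
      exact add_nonneg (h3 x hx) (h3' x hx)
    · rw [divergence_add g (h1 x hx.2) (h1' x hx.2)]
      rcases hx.1 with h | h
      · linarith [min_le_left δ δ', h4 x ⟨h, hx.2⟩, h3' x hx.2]
      · linarith [min_le_right δ δ', h4' x ⟨h, hx.2⟩, h3 x hx.2]
  · intro x hx
    obtain ⟨N, hN, hN'⟩ := h x hx
    exact ⟨N, mem_nhdsWithin_of_mem_nhds hN, hN'⟩

variable [T2Space M]

/-- The set of the points near which an expanding field exists is closed: the expansion is
transported along a chart by a radial field that contracts only near its centre. -/
theorem exists_nhds_hasExpandingField_of_mem_closure (g : Metric n M) {Ω : Set M} {q : M}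
    (hq : q ∈ closure {x | ∃ N ∈ nhds x, HasExpandingField g Ω N}) :
    ∃ N ∈ nhds q, HasExpandingField g Ω N := by
  set e := chartAt (EuclideanSpace ℝ (Fin n)) q
  have he : e ∈ IsManifold.maximalAtlas (𝓡 n) ∞ M := IsManifold.chart_mem_maximalAtlas q
  have hqs : q ∈ e.source := mem_chart_source _ q
  obtain ⟨r, hr, hrt⟩ := Metric.nhds_basis_closedBall.mem_iff.1
    (e.open_target.mem_nhds (e.map_source hqs))
  -- The point `q'` will lie within `R` of `q` in the chart, so the closed ball of radius `R` about
  -- `q'` stays in the chart while its interior contains `q`.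
  set R := r / 2
  have hR : 0 < R := by positivity
  have hU : IsOpen (e.source ∩ e ⁻¹' Metric.ball (e q) R) := e.isOpen_inter_preimage Metric.isOpen_ball
  obtain ⟨q', ⟨hq's, hq'b⟩, N, hN, X, hX1, ⟨C, hX2⟩, hX3, δ, hδ, hX4⟩ :=
    mem_closure_iff.1 hq _ hU ⟨hqs, Metric.mem_ball_self hR⟩
  set c := e q'
  have hcR : ‖e q - c‖ < R := by
    rw [← dist_eq_norm, dist_comm]
    exact hq'b
  have hK : Metric.closedBall c R ⊆ e.target := by
    refine (Metric.closedBall_subset_closedBall' ?_).trans hrt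
    have : dist c (e q) < R := hq'b
    linarith [show R + R = r by simp [R]]
  have hNc : e.symm ⁻¹' N ∈ nhds c := by
    refine (e.continuousAt_symm (e.map_source hq's)).preimage_mem_nhds ?_
    rwa [e.left_inv hq's]
  obtain ⟨ε, hε, hεN⟩ := Metric.mem_nhds_iff.1 hNc
  have hnear : ∀ x ∈ e.source, ‖e x - c‖ < ε → x ∈ N := by
    intro x hx hxc
    have := hεN (show e x ∈ Metric.ball c ε by rwa [Metric.mem_ball, dist_eq_norm])
    rwa [Set.mem_preimage, e.left_inv hx] at this
  -- If `q` is within `ε` of the centre, the given field already expands near it. Otherwise `q` lies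
  -- in the shell where the radial field has positive divergence.
  rcases lt_or_ge ‖e q - c‖ ε with hqε | hqε
  · refine ⟨e.source ∩ e ⁻¹' Metric.ball c ε,
      (e.isOpen_inter_preimage Metric.isOpen_ball).mem_nhds ⟨hqs, ?_⟩, X, hX1, ⟨C, hX2⟩, hX3, δ, hδ,
      fun x hx => hX4 x ⟨hnear x hx.1.1 ?_, hx.2⟩⟩
    · rwa [Set.mem_preimage, Metric.mem_ball, dist_eq_norm]
    · rw [← dist_eq_norm]
      exact hx.1.2
  · set Z := hopfField ((n + 1) / ε ^ 2) R c
    have hZ : ContDiff ℝ ∞ Z := contDiff_hopfField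
    have hZ0 : ∀ y, y ∉ Metric.closedBall c R → Z y = 0 := fun y hy => hopfField_eq_zero hR.le hy
    have hKc := isCompact_closedBall c R
    set Y := chartField g e Z
    have hYs : ∀ x, SmoothAt Y x := smoothAt_chartField g he hZ hKc hK hZ0
    obtain ⟨C', hC'⟩ := exists_vnorm_chartField_le g he hZ hKc hK hZ0
    obtain ⟨m, hm0, hm⟩ := exists_le_divergence_chartField g he hZ hKc hK hZ0
    have hYfar : ∀ x, x ∉ N → 0 ≤ divergence g Y x := by
      intro x hx
      by_cases hxs : x ∈ e.source
      · rw [divergence_chartField g he hZ hxs]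
        have h1 : ε ≤ ‖e x - c‖ := not_lt.1 fun h => hx (hnear x hxs h)
        exact mul_nonneg (inv_nonneg.2 (volDens_pos g he hxs).le)
          (trace_fderiv_hopfField_nonneg hε h1).1
      · exact (divergence_chartField_of_notMem g hKc hK hZ0 hxs).ge
    have hYq : 0 < divergence g Y q := by
      rw [divergence_chartField g he hZ hqs]
      exact mul_pos (inv_pos.2 (volDens_pos g he hqs))
        ((trace_fderiv_hopfField_nonneg hε hqε).2 hcR)
    -- The coefficient of `X`: on `N ∩ Ω` the gain is at least `(m/δ) δ = m`, which offsets the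
    -- worst contraction `-m` of `Y`; off `N` neither term is negative on `Ω`.
    have hκ : 0 ≤ m / δ := by positivity
    have hYc : ContinuousAt (divergence g Y) q := continuousAt_divergence g (.of_forall hYs)
    have hdiv : ∀ x ∈ Ω, divergence g (Y + (m / δ) • X) x =
        divergence g Y x + m / δ * divergence g X x := fun x hx => by
      rw [divergence_add g (hYs x) ((hX1 x hx).const_smul _), divergence_const_smul g (hX1 x hx)]
    refine ⟨{x | divergence g Y q / 2 < divergence g Y x},
      hYc.eventually (lt_mem_nhds (half_lt_self hYq)), Y + (m / δ) • X,
      fun x hx => (hYs x).add ((hX1 x hx).const_smul _), ⟨C' + m / δ * C, fun x hx => ?_⟩,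
      fun x hx => ?_, divergence g Y q / 2, half_pos hYq, fun x hx => ?_⟩
    · refine (vnorm_add_le g _ _).trans (add_le_add (hC' x) ?_)
      rw [Pi.smul_apply, vnorm_smul, abs_of_nonneg hκ]
      exact mul_le_mul_of_nonneg_left (hX2 x hx) hκ
    · rw [hdiv x hx]
      by_cases hxN : x ∈ N
      · have h1 := mul_le_mul_of_nonneg_left (hX4 x ⟨hxN, hx⟩) hκ
        rw [div_mul_cancel₀ _ hδ.ne'] at h1
        linarith [hm x]
      · exact add_nonneg (hYfar x hxN) (mul_nonneg hκ (hX3 x hx))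
    · rw [hdiv x hx.2]
      have h1 : divergence g Y q / 2 < divergence g Y x := hx.1
      linarith [mul_nonneg hκ (hX3 x hx.2)]

/-- Next to a hypersurface in the complement of `Ω` there is an expanding field: a radial field cut
off along the hypersurface. -/
theorem exists_hasExpandingField_of_hypersurface (g : Metric n M) {Ω : Set M}
    {e : OpenPartialHomeomorph M (EuclideanSpace ℝ (Fin n))}
    (he : e ∈ IsManifold.maximalAtlas (𝓡 n) ∞ M) {i : Fin n} {q : M} (hq : q ∈ e.source)
    (hqi : e q i = 0) (h : ∀ x ∈ e.source, e x i = 0 → x ∉ Ω) :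
    ∃ q', q' ∈ connectedComponent q ∧ ∃ N ∈ nhds q', HasExpandingField g Ω N := by
  classical
  obtain ⟨r, hr, hrt⟩ := Metric.nhds_basis_closedBall.mem_iff.1
    (e.open_target.mem_nhds (e.map_source hq))
  set v : EuclideanSpace ℝ (Fin n) := EuclideanSpace.single i 1
  have hv : ‖v‖ = 1 := by simp [v]
  have hvi : v i = 1 := by simp [v]
  -- The centre `c` is placed at depth `ε` on the negative side, so every point with positive
  -- coordinate is at distance at least `ε`. The radius `3ε` exceeds the distance `2ε` to the mirror
  -- point `y'`, and the ball stays within distance `4ε = r` of `e q`.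
  set ε := r / 4
  have hε : 0 < ε := by positivity
  set c := e q - ε • v
  set R := 3 * ε
  have hR : 0 < R := by positivity
  have hK : Metric.closedBall c R ⊆ e.target := by
    refine (Metric.closedBall_subset_closedBall' ?_).trans hrt
    have : dist c (e q) = ε := by simp [c, norm_smul, hv, abs_of_pos hε]
    rw [this]
    simp only [R, ε]
    linarith
  set Z := hopfField ((n + 1) / ε ^ 2) R c
  have hZ : ContDiff ℝ ∞ Z := contDiff_hopfField
  have hZ0 : ∀ y, y ∉ Metric.closedBall c R → Z y = 0 := fun y hy => hopfField_eq_zero hR.le hy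
  have hKc := isCompact_closedBall c R
  set Y := chartField g e Z
  have hYs : ∀ x, SmoothAt Y x := smoothAt_chartField g he hZ hKc hK hZ0
  obtain ⟨C, hC⟩ := exists_vnorm_chartField_le g he hZ hKc hK hZ0
  have hpos : ∀ x, 0 < e x i → ε ≤ ‖e x - c‖ := by
    intro x hx
    have h1 : |(e x - c) i| ≤ ‖e x - c‖ := by
      simpa using PiLp.norm_apply_le (e x - c) i
    have h2 : (e x - c) i = e x i + ε := by simp [c, hqi, hvi]
    rw [h2] at h1
    linarith [le_abs_self (e x i + ε)]
  have hYdiv : ∀ x ∈ e.source, 0 < e x i → 0 ≤ divergence g Y x := by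
    intro x hx hxi
    rw [divergence_chartField g he hZ hx]
    exact mul_nonneg (inv_nonneg.2 (volDens_pos g he hx).le)
      (trace_fderiv_hopfField_nonneg hε (hpos x hxi)).1
  let P : Set M := e.source ∩ e ⁻¹' {y | 0 < y i}
  let Q : Set M := e.source ∩ e ⁻¹' {y | y i < 0}
  have hPo : IsOpen P := e.isOpen_inter_preimage
    (isOpen_lt continuous_const (EuclideanSpace.proj (𝕜 := ℝ) i).continuous)
  have hQo : IsOpen Q := e.isOpen_inter_preimage
    (isOpen_lt (EuclideanSpace.proj (𝕜 := ℝ) i).continuous continuous_const)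
  -- The cut can destroy smoothness only on the hypersurface, which misses `Ω`; outside the chart
  -- `Y` already vanishes.
  let Y' : VField n M := fun x => if x ∈ P then Y x else 0
  have hY'P : ∀ x ∈ P, ∀ᶠ z in nhds x, Y z = Y' z := by
    intro x hx
    filter_upwards [hPo.mem_nhds hx] with z hz
    simp only [Y', if_pos hz]
  have hY'0 : ∀ x ∈ Ω, x ∉ P → ∀ᶠ z in nhds x, (0 : VField n M) z = Y' z := by
    intro x hx hxP
    by_cases hxs : x ∈ e.source
    · have hxQ : x ∈ Q := by
        refine ⟨hxs, lt_of_le_of_ne (not_lt.1 fun h => hxP ⟨hxs, h⟩) fun h0 => h x hxs h0 hx⟩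
      filter_upwards [hQo.mem_nhds hxQ] with z hz
      have : z ∉ P := fun h => lt_asymm (show 0 < e z i from h.2) hz.2
      simp only [Y', if_neg this, Pi.zero_apply]
    · filter_upwards [eventually_chartField_eq_zero g hKc hK hZ0 hxs] with z hz
      simp only [Y', Pi.zero_apply]
      split_ifs
      · exact hz.symm
      · rfl
  set y' := e q + ε • v
  have hy'r : y' ∈ Metric.ball (e q) r := by
    simp only [y', Metric.mem_ball, dist_eq_norm, add_sub_cancel_left, norm_smul, hv,
      Real.norm_eq_abs, abs_of_pos hε, ε]
    linarith
  have hy't : y' ∈ e.target := hrt (Metric.ball_subset_closedBall hy'r)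
  set q' := e.symm y'
  have hq's : q' ∈ e.source := e.map_target hy't
  have heq' : e q' = y' := e.right_inv hy't
  have hq'P : q' ∈ P := by
    refine ⟨hq's, ?_⟩
    change 0 < e q' i
    rw [heq']
    simpa [y', hqi, hvi] using hε
  have hq'div : 0 < divergence g Y q' := by
    rw [divergence_chartField g he hZ hq's]
    refine mul_pos (inv_pos.2 (volDens_pos g he hq's))
      ((trace_fderiv_hopfField_nonneg hε (hpos q' hq'P.2)).2 ?_)
    have : e q' - c = (2 * ε) • v := by
      rw [heq']
      simp only [y', c]
      module
    rw [this, norm_smul, hv, Real.norm_eq_abs, abs_of_pos (by positivity)]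
    simp only [R]
    linarith
  have hYc : ContinuousAt (divergence g Y) q' := continuousAt_divergence g (.of_forall hYs)
  refine ⟨q', ?_, P ∩ {x | divergence g Y q' / 2 < divergence g Y x},
    Filter.inter_mem (hPo.mem_nhds hq'P) (hYc.eventually (lt_mem_nhds (half_lt_self hq'div))),
    Y', ?_, ⟨max C 0, fun x _ => ?_⟩, ?_, divergence g Y q' / 2, half_pos hq'div, ?_⟩
  · have hpre : IsPreconnected (e.symm '' Metric.ball (e q) r) :=
      (convex_ball (e q) r).isPreconnected.image _
        (e.continuousOn_symm.mono (Metric.ball_subset_closedBall.trans hrt))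
    exact hpre.subset_connectedComponent ⟨e q, Metric.mem_ball_self hr, e.left_inv hq⟩
      ⟨y', hy'r, rfl⟩
  · intro x hx
    by_cases hxP : x ∈ P
    · exact (hYs x).congr (hY'P x hxP)
    · exact (smoothAt_zero x).congr (hY'0 x hx hxP)
  · simp only [Y']
    split_ifs
    · exact le_max_of_le_left (hC x)
    · rw [vnorm_zero]
      exact le_max_right _ _
  · intro x hx
    by_cases hxP : x ∈ P
    · rw [← divergence_congr g (hY'P x hxP)]
      exact hYdiv x hxP.1 hxP.2
    · rw [← divergence_congr g (hY'0 x hx hxP), divergence_zero]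
  · rintro x ⟨⟨hxP, hx⟩, -⟩
    rw [← divergence_congr g (hY'P x hxP)]
    exact le_of_lt hx

/-- A clopen set that meets a connected component contains it. Here the set also consists of points
outside `Ω`, which lets the expansion start beside the hypersurface and travel through the whole
component. -/
theorem cConst_pos (g : Metric n M) {Ω : Set M} (hconn : IsConnected Ω)
    (hcomp : IsCompact (closure Ω))
    (h : ∀ z ∈ Ω, ContainsHypersurface n (connectedComponent z \ Ω)) : 0 < cConst g Ω := by
  obtain ⟨z, hz⟩ := hconn.nonempty
  obtain ⟨e, he, i, ⟨q, hq, hqi⟩, hA⟩ := h z hz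
  obtain ⟨q', hq'q, hq'⟩ := exists_hasExpandingField_of_hypersurface g (Ω := Ω) he hq hqi
    fun x hx hxi => (hA x hx hxi).2
  set S := {x | ∃ N ∈ nhds x, HasExpandingField g Ω N}
  have hSo : IsOpen S := by
    rw [isOpen_iff_mem_nhds]
    rintro x ⟨N, hN, hN'⟩
    filter_upwards [eventually_mem_nhds_iff.2 hN] with w hw using ⟨N, hw, hN'⟩
  have hSc : IsClosed S :=
    isClosed_of_closure_subset fun x hx => exists_nhds_hasExpandingField_of_mem_closure g hx
  have h1 : connectedComponent q' = connectedComponent z := by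
    rw [connectedComponent_eq_iff_mem.2 hq'q]
    exact connectedComponent_eq_iff_mem.2 (hA q hq hqi).1
  have h2 : closure Ω ⊆ S := by
    refine (hconn.isPreconnected.closure.subset_connectedComponent (subset_closure hz)).trans ?_
    rw [← h1]
    exact IsClopen.connectedComponent_subset ⟨hSc, hSo⟩ hq'
  obtain ⟨X, hX1, ⟨C, hX2⟩, -, δ, hδ, hX4⟩ := hasExpandingField_of_isCompact g hcomp h2
  have hX : IsAdmissible g Ω X :=
    ⟨fun x hx => (hX1 x hx).contMDiffWithinAt, ⟨C, hX2⟩, δ, hδ,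
      fun x hx => hX4 x ⟨subset_closure hx, hx⟩⟩
  refine lt_of_lt_of_le ?_ (le_iSup₂ (f := fun (X : VField n M) (_ : IsAdmissible g Ω X) =>
    (⨅ x ∈ Ω, ENNReal.ofReal (divergence g X x)) / (⨆ x ∈ Ω, ENNReal.ofReal (vnorm g (X x)))) X hX)
  -- A positive numerator and a finite denominator suffice; a zero denominator would only make the
  -- quotient infinite.
  refine ENNReal.div_pos ?_ ?_
  · have : ENNReal.ofReal δ ≤ ⨅ x ∈ Ω, ENNReal.ofReal (divergence g X x) :=
      le_iInf₂ fun x hx => ENNReal.ofReal_le_ofReal (hX4 x ⟨subset_closure hx, hx⟩)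
    exact ((ENNReal.ofReal_pos.2 hδ).trans_le this).ne'
  · have : (⨆ x ∈ Ω, ENNReal.ofReal (vnorm g (X x))) ≤ ENNReal.ofReal C :=
      iSup₂_le fun x hx => ENNReal.ofReal_le_ofReal (hX2 x hx)
    exact (this.trans_lt ENNReal.ofReal_lt_top).ne

end Fields

end PTone

end

theorem theorem1p1 {n : ℕ} {M : Type*} [TopologicalSpace M] [T2Space M]
    [SecondCountableTopology M] [ChartedSpace (EuclideanSpace ℝ (Fin n)) M]
    [IsManifold (𝓡 n) ∞ M] [MeasurableSpace M] [BorelSpace M]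
    (g : PTone.Metric n M) (p : ℝ) (hp : 1 < p)
    (Ω : Set M) (hopen : IsOpen Ω) (hconn : IsConnected Ω) (hbd : (frontier Ω).Nonempty) :
    PTone.cConst g Ω ^ p / ENNReal.ofReal p ^ p ≤ PTone.fundamentalTone g p Ω ∧
      (IsCompact (closure Ω) →
        (∀ z ∈ Ω, PTone.ContainsHypersurface n (connectedComponent z \ Ω)) →
        0 < PTone.cConst g Ω ^ p / ENNReal.ofReal p ^ p) := by
  have hp0 : 0 < p := by linarith
  refine ⟨PTone.cConst_rpow_div_le_fundamentalTone g hp hopen hconn.nonempty, fun hcomp h => ?_⟩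
  refine ENNReal.div_pos (ENNReal.rpow_pos_of_nonneg (PTone.cConst_pos g hconn hcomp h) hp0.le).ne' ?_
  exact ENNReal.rpow_ne_top_of_nonneg hp0.le ENNReal.ofReal_ne_top
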